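/- **Definitions.** A loop in a simplicial complex $X$ is a subcomplex $\gamma$ that is a triangulated circle. A filling diagram for $\gamma$ is a simplicial map $f:D\to X$, where $D$ is a (finite) triangulated $2$-disc, mapping $\partial D$ isomorphically onto $\gamma$; it is minimal if $D$ has the least number of triangles among all filling diagrams for $\gamma$. Distances in $D$ are taken in its $1$-skeleton, $\deg w$ is the number of neighbours of $w$ in $D$, and a $k$-vertex of $D$ is an interior vertex with $k$ neighbours. For $s,t\ge 4$, a flag, simply connected simplicial complex $X$ is $(s,t)$-uniform if for every loop $\gamma$ in $X$ and every minimal filling diagram $(D,f)$ for $\gamma$ the following holds. If $s=t$: every interior vertex of $D$ is a $t$-vertex. If $s\ne t$: every interior vertex of $D$ is an $s$-vertex or a $t$-vertex; all neighbours of an $s$-vertex are $t$-vertices or boundary vertices; and the neighbours of a $t$-vertex form a full cycle $(v_1,\dots,v_t)$ in which the vertices with odd index are $t$-vertices or boundary vertices and those with even index are $s$-vertices or boundary vertices. **Theorem.** Let $s,t\ge 6$ be integers with $t$ even and $(s,t)\neq(6,6)$. Put $S=s-4$, $T=t-4$ and $$P=\frac{T+\sqrt{T^2+8ST}}{4}.$$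 There is a sequence of real numbers $(\kappa_n)_{n\ge 1}$, depending only on $s$ and $t$, such that the following holds for every $(s,t)$-uniform simplicial complex $X$, every loop $\gamma$ in $X$, every minimal filling diagram $(D,f)$ for $\gamma$, every $s$-vertex $v$ of $D$, and every $n\ge 1$ such that all vertices of $D$ at distance less than $n$ from $v$ are interior vertices of $D$. The average combinatorial Gaussian curvature inside the sphere $S_n$ of radius $n$ centered at $v$, $$K_{Avg}(S_n)=\frac{\sum_{w:\,d(v,w)<n}(6-\deg w)}{\#\{w:\ d(v,w)<n\}},$$ is equal to $\kappa_n$. Moreover $$\lim_{n\to\infty}\kappa_n = 2-P,$$ that is, $\lim_{n\to\infty}K_{Avg}(S_n)=2-\frac{T+\sqrt{T^2+8ST}}{4}$. -/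

import Mathlib

open Filter Topology

noncomputable section

namespace STUniform

/-! ### Simplicial complexes: one-skeleton, flagness, links, cycles and arcs -/

/-- `a` and `b` lie in a common simplex, i.e. they are equal or span an edge (for vertices). -/
def Joined {V : Type*} (K : PreAbstractSimplicialComplex V) (a b : V) : Prop :=
  ∃ σ ∈ K.faces, a ∈ σ ∧ b ∈ σ

/-- The one-skeleton as a graph. -/
def skeleton {V : Type*} (K : PreAbstractSimplicialComplex V) : SimpleGraph V where
  Adj a b := a ≠ b ∧ Joined K a b
  symm := ⟨fun _ _ h => ⟨h.1.symm, h.2.imp fun _ hσ => ⟨hσ.1, hσ.2.2, hσ.2.1⟩⟩⟩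
  loopless := ⟨fun _ h => h.1 rfl⟩

/-- Every finite nonempty set of pairwise joined vertices spans a simplex. -/
def IsFlag {V : Type*} (K : PreAbstractSimplicialComplex V) : Prop :=
  ∀ s : Finset V, s.Nonempty → (∀ a ∈ s, ∀ b ∈ s, Joined K a b) → s ∈ K.faces

/-- The link of the vertex `v`: the simplices that do not contain `v` and that span a simplex
together with `v`. -/
def link {V : Type*} (K : PreAbstractSimplicialComplex V) (v : V) :
    PreAbstractSimplicialComplex V where
  faces := {σ | σ.Nonempty ∧ v ∉ σ ∧ ∃ τ ∈ K.faces, v ∈ τ ∧ σ ⊆ τ}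
  isRelLowerSet_faces := fun {_} h => ⟨h.1, fun _ hts ht =>
    ⟨ht, fun hv => h.2.1 (hts hv), h.2.2.imp fun _ hτ => ⟨hτ.1, hτ.2.1, hts.trans hτ.2.2⟩⟩⟩

/-- The full subcomplex spanned by a set of vertices. -/
def fullSpan {V : Type*} (K : PreAbstractSimplicialComplex V) (A : Set V) :
    PreAbstractSimplicialComplex V where
  faces := {σ | σ ∈ K.faces ∧ (σ : Set V) ⊆ A}
  isRelLowerSet_faces := fun {_} h => ⟨(K.isRelLowerSet_faces h.1).1, fun _ hts ht =>
    ⟨(K.isRelLowerSet_faces h.1).2 hts ht, fun _ hx => h.2 (hts hx)⟩⟩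

/-- `c` is a cyclic enumeration exhibiting `K` as a triangulated circle with `k` vertices. -/
def IsCycleEnum {V : Type*} (K : PreAbstractSimplicialComplex V) (k : ℕ) (c : ZMod k → V) :
    Prop :=
  3 ≤ k ∧ Function.Injective c ∧
    ∀ σ : Finset V, σ ∈ K.faces ↔
      ∃ i : ZMod k, (σ : Set V) = {c i} ∨ (σ : Set V) = {c i, c (i + 1)}

/-- `K` is a triangulation of the circle. -/
def IsCycle {V : Type*} (K : PreAbstractSimplicialComplex V) : Prop :=
  ∃ (k : ℕ) (c : ZMod k → V), IsCycleEnum K k c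

/-- `K` is a triangulation of a compact interval (with `k ≥ 1` edges). -/
def IsArc {V : Type*} (K : PreAbstractSimplicialComplex V) : Prop :=
  ∃ (k : ℕ) (c : ℕ → V), 1 ≤ k ∧ Set.InjOn c (Set.Iic k) ∧
    ∀ σ : Finset V, σ ∈ K.faces ↔
      (∃ i ≤ k, (σ : Set V) = {c i}) ∨ (∃ i < k, (σ : Set V) = {c i, c (i + 1)})

/-- A loop of `X`: a subcomplex of `X` that is a triangulated circle. -/
def IsLoop {V : Type*} (X : AbstractSimplicialComplex V) (γ : PreAbstractSimplicialComplex V) :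
    Prop :=
  γ ≤ X.toPreAbstractSimplicialComplex ∧ IsCycle γ

/-! ### Simple connectedness, through edge paths -/

/-- An elementary move of edge paths (lists of vertices): `a, b, c` is replaced by `a, c` when
`a, b, c` (not necessarily distinct) lie in a common simplex. -/
inductive EdgeMove {V : Type*} (K : PreAbstractSimplicialComplex V) : List V → List V → Prop
  | mk (l₁ l₂ : List V) (a b c : V) (h : ∃ σ ∈ K.faces, a ∈ σ ∧ b ∈ σ ∧ c ∈ σ) :
      EdgeMove K (l₁ ++ a :: b :: c :: l₂) (l₁ ++ a :: c :: l₂)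

/-- `K` is connected and its edge-path group is trivial: every closed edge path
`a, l₁, …, lₘ, a` can be changed to the constant edge path `a, a` by elementary moves and their
inverses. -/
structure IsSimplyConnected {V : Type*} (K : AbstractSimplicialComplex V) : Prop where
  connected : (skeleton K.toPreAbstractSimplicialComplex).Connected
  closed_path : ∀ (a : V) (l : List V),
    (a :: (l ++ [a])).IsChain (Joined K.toPreAbstractSimplicialComplex) →
      Relation.EqvGen (EdgeMove K.toPreAbstractSimplicialComplex) (a :: (l ++ [a])) [a, a]

/-! ### Triangulated discs and filling diagrams -/

/-- A vertex of a triangulated surface is interior when its link is a circle. -/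
def IsInterior {W : Type*} (D : AbstractSimplicialComplex W) (v : W) : Prop :=
  IsCycle (link D.toPreAbstractSimplicialComplex v)

/-- A triangulated 2-disc: a finite triangulated surface (every vertex link is a circle or an arc)
which is simply connected and has non-empty boundary. -/
structure IsDisc {W : Type*} (D : AbstractSimplicialComplex W) : Prop where
  finite : Finite W
  simplyConnected : IsSimplyConnected D
  surface : ∀ v : W, IsInterior D v ∨ IsArc (link D.toPreAbstractSimplicialComplex v)
  boundary : ∃ v : W, ¬ IsInterior D v

/-- The boundary complex of a triangulated surface: the edges that lie in exactly one triangle,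
with their vertices. -/
def boundaryComplex {W : Type*} (D : AbstractSimplicialComplex W) :
    PreAbstractSimplicialComplex W where
  faces := {σ | σ.Nonempty ∧ ∃ e ∈ D.faces, e.card = 2 ∧
    (∃! τ : Finset W, τ ∈ D.faces ∧ τ.card = 3 ∧ e ⊆ τ) ∧ σ ⊆ e}
  isRelLowerSet_faces := fun {_} h => ⟨h.1, fun _ hts ht =>
    ⟨ht, h.2.imp fun _ he => ⟨he.1, he.2.1, he.2.2.1, hts.trans he.2.2.2⟩⟩⟩

/-- A simplicial map, given on vertices: the image of every simplex is a simplex. -/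
def IsSimplicialMap {W V : Type*} (D : AbstractSimplicialComplex W)
    (X : AbstractSimplicialComplex V) (f : W → V) : Prop :=
  ∀ σ ∈ D.faces, ∃ τ ∈ X.faces, (τ : Set V) = f '' (σ : Set W)

/-- `(D, f)` is a filling diagram for `γ`: `D` is a triangulated disc, `f : D → X` is simplicial,
and `f` maps the boundary of `D` isomorphically onto `γ`. -/
structure IsFilling {V W : Type*} (X : AbstractSimplicialComplex V)
    (γ : PreAbstractSimplicialComplex V) (D : AbstractSimplicialComplex W) (f : W → V) :
    Prop where
  disc : IsDisc D
  simplicial : IsSimplicialMap D X f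
  injOn : Set.InjOn f {w | {w} ∈ (boundaryComplex D).faces}
  image : ∀ τ : Finset V, τ ∈ γ.faces ↔
    ∃ σ ∈ (boundaryComplex D).faces, (τ : Set V) = f '' (σ : Set W)

/-- The area: the number of triangles. -/
def area {W : Type*} (D : AbstractSimplicialComplex W) : ℕ :=
  {τ : Finset W | τ ∈ D.faces ∧ τ.card = 3}.ncard

/-- A filling diagram of least area among all filling diagrams of `γ`. (Discs are finite, so it is
enough to consider vertex sets in the lowest universe.) -/
def IsMinimalFilling {V : Type*} (X : AbstractSimplicialComplex V)
    (γ : PreAbstractSimplicialComplex V) {W : Type} (D : AbstractSimplicialComplex W)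
    (f : W → V) : Prop :=
  IsFilling X γ D f ∧
    ∀ (W' : Type) (D' : AbstractSimplicialComplex W') (f' : W' → V),
      IsFilling X γ D' f' → area D ≤ area D'

/-! ### `(s,t)`-uniform complexes -/

/-- The number of neighbours of a vertex. -/
def degree {W : Type*} (D : AbstractSimplicialComplex W) (v : W) : ℕ :=
  ((skeleton D.toPreAbstractSimplicialComplex).neighborSet v).ncard

/-- A `k`-vertex of a disc: an interior vertex with `k` neighbours. -/
def IsKVertex {W : Type*} (D : AbstractSimplicialComplex W) (k : ℕ) (v : W) : Prop :=
  IsInterior D v ∧ degree D v = k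

/-- The conditions on a minimal filling diagram `D` in the definition of an `(s,t)`-uniform
complex for `s ≠ t`. -/
structure IsUniformDiagram {W : Type*} (D : AbstractSimplicialComplex W) (s t : ℕ) : Prop where
  /-- Every interior vertex is an `s`-vertex or a `t`-vertex. -/
  interior : ∀ v, IsInterior D v → IsKVertex D s v ∨ IsKVertex D t v
  /-- Neighbours of an `s`-vertex are `t`-vertices or boundary vertices. -/
  s_vertex : ∀ v, IsKVertex D s v →
    ∀ w, (skeleton D.toPreAbstractSimplicialComplex).Adj v w → IsKVertex D t w ∨ ¬ IsInterior D w
  /-- The neighbours of a `t`-vertex form a full cycle `(c 1, …, c t)`, with `t`-vertices or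
  boundary vertices at odd indices and `s`-vertices or boundary vertices at even indices. -/
  t_vertex : ∀ v, IsKVertex D t v →
    ∃ c : ZMod t → W,
      IsCycleEnum (fullSpan D.toPreAbstractSimplicialComplex
        ((skeleton D.toPreAbstractSimplicialComplex).neighborSet v)) t c ∧
      ∀ j : ℕ, 1 ≤ j → j ≤ t →
        (Odd j → IsKVertex D t (c j) ∨ ¬ IsInterior D (c j)) ∧
        (Even j → IsKVertex D s (c j) ∨ ¬ IsInterior D (c j))

/-- `(s,t)`-uniform complexes. For `s = t` this is `t`-uniformness: every interior vertex of every
minimal filling diagram has exactly `t` neighbours. -/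
structure IsUniform {V : Type*} (X : AbstractSimplicialComplex V) (s t : ℕ) : Prop where
  four_le_s : 4 ≤ s
  four_le_t : 4 ≤ t
  flag : IsFlag X.toPreAbstractSimplicialComplex
  simplyConnected : IsSimplyConnected X
  of_eq : s = t → ∀ γ : PreAbstractSimplicialComplex V, IsLoop X γ →
    ∀ (W : Type) (D : AbstractSimplicialComplex W) (f : W → V), IsMinimalFilling X γ D f →
      ∀ v, IsInterior D v → IsKVertex D t v
  of_ne : s ≠ t → ∀ γ : PreAbstractSimplicialComplex V, IsLoop X γ →
    ∀ (W : Type) (D : AbstractSimplicialComplex W) (f : W → V), IsMinimalFilling X γ D f →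
      IsUniformDiagram D s t

/-! ### Curvature inside spheres -/

/-- The vertices inside the sphere `S_n` centered at `v`: those at distance less than `n`. -/
def inside {W : Type*} (D : AbstractSimplicialComplex W) (v : W) (n : ℕ) : Set W :=
  {w | (skeleton D.toPreAbstractSimplicialComplex).dist v w < n}

/-- The average of the combinatorial Gaussian curvature `6 - deg w` over the vertices `w` inside
the sphere `S_n` centered at `v`. -/
def avgCurvature {W : Type*} (D : AbstractSimplicialComplex W) (v : W) (n : ℕ) : ℝ :=
  (∑ᶠ w ∈ inside D v n, (6 - (degree D w : ℝ))) / ((inside D v n).ncard : ℝ)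

end STUniform

end

/-!
The distance from `v` layers `D` as in nonpositive curvature: two adjacent vertices of a sphere have
a common neighbour on the previous sphere, and two neighbours of a vertex on the previous sphere are
adjacent. Either configuration lies on a bigon, formed by two geodesics from a common point and one
or two edges joining their ends. As `D` is simply connected, the bigon bounds modulo `2` a set of
triangles. For a bigon of least length and least area every vertex inside a geodesic has angle at
least `π`, so Gauss–Bonnet with interior degrees at least `6` bounds the angles on the joining path
so strongly that the triangles along it provide the vertex or edge asked for.

Hence the levels around a vertex of level `k + 1` are `k` once or twice, `k + 1` twice and `k + 2`
otherwise. Counting the edges and triangles between consecutive spheres by the types of their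
vertices gives a linear recurrence for the numbers of `s`- and `t`-vertices of the spheres. It is
solved by Chebyshev polynomials at the roots `p = P` and `q` of `x² - (T / 2) x - S T / 2`. Since
`|q| < p` and `2 < p`, the terms at `p` dominate and the average tends to `2 - p`.
-/

namespace STUniform

open scoped Finset

section Cycles

variable {V : Type*} {K : PreAbstractSimplicialComplex V} {k : ℕ}

/-- `c 0, …, c k` is an injective enumeration exhibiting `K` as a triangulated interval with `k`
edges. -/
def IsArcEnum (K : PreAbstractSimplicialComplex V) (k : ℕ) (c : ℕ → V) : Prop :=
  1 ≤ k ∧ Set.InjOn c (Set.Iic k) ∧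
    ∀ σ : Finset V, σ ∈ K.faces ↔
      (∃ i ≤ k, (σ : Set V) = {c i}) ∨ (∃ i < k, (σ : Set V) = {c i, c (i + 1)})

theorem natCast_zmod_ne_zero {m : ℕ} (hm : m ≠ 0) (hmk : m < k) : (m : ZMod k) ≠ 0 := by
  rw [Ne, ZMod.natCast_eq_zero_iff]
  exact Nat.not_dvd_of_pos_of_lt (Nat.pos_of_ne_zero hm) hmk

theorem IsCycleEnum.one_ne_zero {c : ZMod k → V} (h : IsCycleEnum K k c) : (1 : ZMod k) ≠ 0 := by
  simpa using natCast_zmod_ne_zero Nat.one_ne_zero (Nat.lt_of_succ_lt h.1)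

theorem IsCycleEnum.ne_add_one {c : ZMod k → V} (h : IsCycleEnum K k c) (i : ZMod k) :
    c i ≠ c (i + 1) := fun hi =>
  h.one_ne_zero (left_eq_add.1 (h.2.1 hi))

theorem IsCycleEnum.ne_add_two {c : ZMod k → V} (h : IsCycleEnum K k c) (i : ZMod k) :
    c i ≠ c (i + 1 + 1) := fun hi => by
  have h2 : ((2 : ℕ) : ZMod k) ≠ 0 := natCast_zmod_ne_zero two_ne_zero h.1
  have h0 := h.2.1 hi
  rw [add_assoc, left_eq_add] at h0
  exact h2 (by rw [← h0]; norm_num)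

theorem IsCycleEnum.singleton_mem_iff {c : ZMod k → V} (h : IsCycleEnum K k c) {x : V} :
    {x} ∈ K.faces ↔ ∃ i, x = c i := by
  simp only [h.2.2, Finset.coe_singleton, Set.singleton_eq_singleton_iff]
  refine exists_congr fun i => or_iff_left fun hi => h.ne_add_one i ?_
  exact (Set.mem_singleton_iff.1 (hi ▸ by simp)).trans
    (Set.mem_singleton_iff.1 (hi ▸ by simp : c (i + 1) ∈ ({x} : Set V))).symm

theorem skeleton_adj_iff [DecidableEq V] {a b : V} :
    (skeleton K).Adj a b ↔ a ≠ b ∧ {a, b} ∈ K.faces := by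
  refine and_congr_right fun _ => ⟨?_, fun h => ⟨_, h, by simp, by simp⟩⟩
  rintro ⟨σ, hσ, ha, hb⟩
  exact (K.isRelLowerSet_faces hσ).2 (by simp [Finset.insert_subset_iff, ha, hb]) (by simp)

theorem pair_ne_singleton {x y z : V} (hxy : x ≠ y) : ({x, y} : Set V) ≠ {z} := fun h =>
  hxy <| (Set.mem_singleton_iff.1 (h ▸ by simp)).trans
    (Set.mem_singleton_iff.1 (h ▸ by simp : y ∈ ({z} : Set V))).symm

theorem IsCycleEnum.adj_iff {c : ZMod k → V} (h : IsCycleEnum K k c) {x y : V} :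
    (skeleton K).Adj x y ↔ ∃ i, (x = c i ∧ y = c (i + 1)) ∨ (x = c (i + 1) ∧ y = c i) := by
  classical
  simp only [skeleton_adj_iff, h.2.2, Finset.coe_pair]
  refine ⟨fun ⟨hxy, i, hi⟩ => ⟨i, ?_⟩, fun ⟨i, hi⟩ => ⟨?_, i, Or.inr (Set.pair_eq_pair_iff.2 hi)⟩⟩
  · exact Set.pair_eq_pair_iff.1 (hi.resolve_left (pair_ne_singleton hxy))
  · rcases hi with ⟨rfl, rfl⟩ | ⟨rfl, rfl⟩
    exacts [h.ne_add_one i, (h.ne_add_one i).symm]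

theorem IsArcEnum.adj_iff {c : ℕ → V} (h : IsArcEnum K k c) {x y : V} :
    (skeleton K).Adj x y ↔
      ∃ i < k, (x = c i ∧ y = c (i + 1)) ∨ (x = c (i + 1) ∧ y = c i) := by
  classical
  simp only [skeleton_adj_iff, h.2.2, Finset.coe_pair]
  refine ⟨fun ⟨hxy, hσ⟩ => ?_, fun ⟨i, hik, hi⟩ =>
    ⟨?_, Or.inr ⟨i, hik, Set.pair_eq_pair_iff.2 hi⟩⟩⟩
  · obtain ⟨i, hik, hi⟩ := hσ.resolve_left fun ⟨_, _, hi⟩ => pair_ne_singleton hxy hi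
    exact ⟨i, hik, Set.pair_eq_pair_iff.1 hi⟩
  · have hne : c i ≠ c (i + 1) := fun h' =>
      absurd (h.2.1 (Set.mem_Iic.2 hik.le) (Set.mem_Iic.2 hik) h') (by lia)
    rcases hi with ⟨rfl, rfl⟩ | ⟨rfl, rfl⟩
    exacts [hne, hne.symm]

theorem IsCycleEnum.eq_or_eq_of_adj {c : ZMod k → V} (h : IsCycleEnum K k c) {i : ZMod k} {y : V}
    (hy : (skeleton K).Adj (c i) y) : y = c (i + 1) ∨ y = c (i - 1) := by
  obtain ⟨j, ⟨hi, rfl⟩ | ⟨hi, rfl⟩⟩ := h.adj_iff.1 hy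
  · exact Or.inl (by rw [h.2.1 hi])
  · exact Or.inr (by rw [h.2.1 hi, add_sub_cancel_right])

theorem IsArcEnum.eq_or_eq_of_adj {c : ℕ → V} (h : IsArcEnum K k c) {i : ℕ} (hi : i ≤ k) {y : V}
    (hy : (skeleton K).Adj (c i) y) :
    (i < k ∧ y = c (i + 1)) ∨ (0 < i ∧ y = c (i - 1)) := by
  obtain ⟨j, hj, ⟨hij, rfl⟩ | ⟨hij, rfl⟩⟩ := h.adj_iff.1 hy
  · obtain rfl := h.2.1 hi (Set.mem_Iic.2 hj.le) hij
    exact Or.inl ⟨hj, rfl⟩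
  · obtain rfl := h.2.1 hi (Set.mem_Iic.2 hj) hij
    exact Or.inr ⟨Nat.succ_pos j, rfl⟩

theorem IsCycle.exists_two_neighbors (h : IsCycle K) (x : V) :
    ∃ y₁ y₂, ∀ y, (skeleton K).Adj x y → y = y₁ ∨ y = y₂ := by
  obtain ⟨k, c, h⟩ := h
  by_cases hx : ∃ i, x = c i
  · obtain ⟨i, rfl⟩ := hx
    exact ⟨_, _, fun y => h.eq_or_eq_of_adj⟩
  · refine ⟨x, x, fun y hy => ?_⟩
    obtain ⟨i, ⟨hi, -⟩ | ⟨hi, -⟩⟩ := h.adj_iff.1 hy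
    exacts [(hx ⟨_, hi⟩).elim, (hx ⟨_, hi⟩).elim]

theorem IsArc.exists_two_neighbors (h : IsArc K) (x : V) :
    ∃ y₁ y₂, ∀ y, (skeleton K).Adj x y → y = y₁ ∨ y = y₂ := by
  obtain ⟨k, c, h⟩ : ∃ k c, IsArcEnum K k c := h
  by_cases hx : ∃ i ≤ k, x = c i
  · obtain ⟨i, hi, rfl⟩ := hx
    exact ⟨_, _, fun y hy => (h.eq_or_eq_of_adj hi hy).imp And.right And.right⟩
  · refine ⟨x, x, fun y hy => ?_⟩
    obtain ⟨i, hik, ⟨hi, -⟩ | ⟨hi, -⟩⟩ := h.adj_iff.1 hy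
    exacts [(hx ⟨_, hik.le, hi⟩).elim, (hx ⟨_, hik, hi⟩).elim]

/-- No vertex of `H` has exactly one neighbour. -/
def IsLeafless (H : SimpleGraph V) : Prop :=
  ∀ ⦃x y⦄, H.Adj x y → ∃ z ≠ y, H.Adj x z

theorem IsArcEnum.not_adj_of_isLeafless {c : ℕ → V} (h : IsArcEnum K k c) {H : SimpleGraph V}
    (hK : H ≤ skeleton K) (hH : IsLeafless H) {i : ℕ} (hi : i < k) : ¬ H.Adj (c i) (c (i + 1)) := by
  induction i with
  | zero =>
    intro hadj
    obtain ⟨z, hz, hadj'⟩ := hH hadj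
    rcases h.eq_or_eq_of_adj hi.le (hK hadj') with ⟨-, rfl⟩ | ⟨h0, -⟩
    exacts [hz rfl, h0.false]
  | succ i ih =>
    intro hadj
    obtain ⟨z, hz, hadj'⟩ := hH hadj
    rcases h.eq_or_eq_of_adj hi.le (hK hadj') with ⟨-, rfl⟩ | ⟨-, rfl⟩
    exacts [hz rfl, ih (Nat.lt_of_succ_lt hi) hadj'.symm]

theorem IsArc.eq_bot_of_isLeafless (h : IsArc K) {H : SimpleGraph V} (hK : H ≤ skeleton K)
    (hH : IsLeafless H) : H = ⊥ := by
  obtain ⟨k, c, h⟩ : ∃ k c, IsArcEnum K k c := h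
  refine SimpleGraph.eq_bot_iff_forall_not_adj.2 fun x y hxy => ?_
  obtain ⟨i, hi, ⟨rfl, rfl⟩ | ⟨rfl, rfl⟩⟩ := h.adj_iff.1 (hK hxy)
  exacts [h.not_adj_of_isLeafless hK hH hi hxy, h.not_adj_of_isLeafless hK hH hi hxy.symm]

theorem IsCycleEnum.adj_of_isLeafless {c : ZMod k → V} (h : IsCycleEnum K k c) {H : SimpleGraph V}
    (hK : H ≤ skeleton K) (hH : IsLeafless H) (hne : H ≠ ⊥) (i : ZMod k) :
    H.Adj (c i) (c (i + 1)) := by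
  have : NeZero k := ⟨by have := h.1; lia⟩
  have hstep (j : ZMod k) (hj : H.Adj (c j) (c (j + 1))) : H.Adj (c (j + 1)) (c (j + 1 + 1)) := by
    obtain ⟨z, hz, hadj⟩ := hH hj.symm
    rcases h.eq_or_eq_of_adj (hK hadj) with rfl | rfl
    exacts [hadj, (hz (by rw [add_sub_cancel_right])).elim]
  obtain ⟨j, hj⟩ : ∃ j, H.Adj (c j) (c (j + 1)) := by
    obtain ⟨x, y, hxy⟩ := SimpleGraph.ne_bot_iff_exists_adj.1 hne
    obtain ⟨j, ⟨rfl, rfl⟩ | ⟨rfl, rfl⟩⟩ := h.adj_iff.1 (hK hxy)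
    exacts [⟨j, hxy⟩, ⟨j, hxy.symm⟩]
  have hall (n : ℕ) : H.Adj (c (j + n)) (c (j + n + 1)) := by
    induction n with
    | zero => simpa using hj
    | succ n ih => rw [Nat.cast_succ, ← add_assoc]; exact hstep _ ih
  have := hall (i - j).val
  rwa [ZMod.natCast_zmod_val, add_sub_cancel] at this

theorem IsCycleEnum.injective_edge [DecidableEq V] {c : ZMod k → V} (h : IsCycleEnum K k c) :
    Function.Injective fun i => ({c i, c (i + 1)} : Finset V) := by
  intro i j hij
  have hij' : ({c i, c (i + 1)} : Set V) = {c j, c (j + 1)} := by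
    simpa using congrArg (fun s : Finset V => (s : Set V)) hij
  rcases Set.pair_eq_pair_iff.1 hij' with ⟨hi, -⟩ | ⟨hi, hj⟩
  · exact h.2.1 hi
  · rw [h.2.1 hi] at hj
    exact (h.ne_add_two j hj.symm).elim

end Cycles

section Links

variable {W : Type*} {D : AbstractSimplicialComplex W}

/-- The 1-skeleton of `D`. -/
abbrev graph (D : AbstractSimplicialComplex W) : SimpleGraph W :=
  skeleton D.toPreAbstractSimplicialComplex

/-- The link of the vertex `w` in `D`. -/
abbrev vertexLink (D : AbstractSimplicialComplex W) (w : W) : PreAbstractSimplicialComplex W :=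
  link D.toPreAbstractSimplicialComplex w

/-- Every vertex link of `D` is a circle or an arc. -/
def IsSurface (D : AbstractSimplicialComplex W) : Prop :=
  ∀ w, IsInterior D w ∨ IsArc (vertexLink D w)

theorem mem_link_iff [DecidableEq W] {w : W} {σ : Finset W} :
    σ ∈ (vertexLink D w).faces ↔ σ.Nonempty ∧ w ∉ σ ∧ insert w σ ∈ D.faces := by
  refine and_congr_right fun _ => and_congr_right fun _ =>
    ⟨?_, fun h => ⟨_, h, by simp, Finset.subset_insert _ _⟩⟩
  rintro ⟨τ, hτ, hw, hsub⟩
  exact (D.isRelLowerSet_faces hτ).2 (Finset.insert_subset hw hsub) (by simp)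

theorem singleton_mem_link_iff {w x : W} : {x} ∈ (vertexLink D w).faces ↔ (graph D).Adj w x := by
  classical
  simp [mem_link_iff, skeleton_adj_iff]

theorem link_adj_iff [DecidableEq W] {w x y : W} :
    (skeleton (vertexLink D w)).Adj x y ↔ x ≠ y ∧ w ≠ x ∧ w ≠ y ∧ {w, x, y} ∈ D.faces := by
  simp [mem_link_iff, skeleton_adj_iff, and_assoc]

theorem IsCycleEnum.degree_eq {w : W} {k : ℕ} {c : ZMod k → W}
    (h : IsCycleEnum (vertexLink D w) k c) : degree D w = k := by
  have : (graph D).neighborSet w = Set.range c := by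
    ext x
    rw [SimpleGraph.mem_neighborSet, ← singleton_mem_link_iff, h.singleton_mem_iff]
    simp only [Set.mem_range, eq_comm]
  rw [degree, this, ← Set.image_univ, Set.ncard_image_of_injective _ h.2.1, Set.ncard_univ,
    Nat.card_zmod]

end Links

section Triangles

variable {W : Type*} [DecidableEq W] {D : AbstractSimplicialComplex W} {T : Finset (Finset W)}

/-- `T` is a set of triangles of `D`. -/
def IsTriangles (D : AbstractSimplicialComplex W) (T : Finset (Finset W)) : Prop :=
  ∀ t ∈ T, t ∈ D.faces ∧ #t = 3

/-- The number of triangles of `T` that contain the edge `e`. -/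
def edgeDegree (T : Finset (Finset W)) (e : Finset W) : ℕ :=
  #{t ∈ T | e ⊆ t}

/-- The angle at `w` of the region covered by the triangles of `T`, in units of `π / 3`: every
triangle is thought of as equilateral. -/
def angle (T : Finset (Finset W)) (w : W) : ℕ :=
  #{t ∈ T | w ∈ t}

/-- The link of `w` in the complex generated by the triangles of `T`, as a graph. -/
def triangleLink (T : Finset (Finset W)) (w : W) : SimpleGraph W where
  Adj x y := x ≠ y ∧ w ≠ x ∧ w ≠ y ∧ {w, x, y} ∈ T
  symm := ⟨fun x y h => ⟨h.1.symm, h.2.2.1, h.2.1, Finset.pair_comm x y ▸ h.2.2.2⟩⟩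
  loopless := ⟨fun _ h => h.1 rfl⟩

theorem exists_eq_triple_of_mem {w : W} {t : Finset W} (ht : #t = 3) (hw : w ∈ t) :
    ∃ x y, w ≠ x ∧ w ≠ y ∧ x ≠ y ∧ t = {w, x, y} := by
  obtain ⟨x, y, hxy, h⟩ := Finset.card_eq_two.1 (by
    rw [Finset.card_erase_of_mem hw, ht] : #(t.erase w) = 2)
  have hx : x ∈ t.erase w := h ▸ by simp
  have hy : y ∈ t.erase w := h ▸ by simp
  refine ⟨x, y, (Finset.ne_of_mem_erase hx).symm, (Finset.ne_of_mem_erase hy).symm, hxy, ?_⟩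
  rw [← h, Finset.insert_erase hw]

theorem exists_eq_triple_of_pair_subset {w x : W} {t : Finset W} (hwx : w ≠ x) (ht : #t = 3)
    (h : {w, x} ⊆ t) : ∃ y, w ≠ y ∧ x ≠ y ∧ t = {w, x, y} := by
  obtain ⟨y, hy, rfl⟩ := Finset.exists_eq_insert_iff.2 ⟨h, by rw [ht, Finset.card_pair hwx]⟩
  simp only [Finset.mem_insert, Finset.mem_singleton, not_or] at hy
  exact ⟨y, Ne.symm hy.1, Ne.symm hy.2, by rw [Finset.insert_comm, Finset.pair_comm y]⟩

theorem IsTriangles.triangleLink_le (hT : IsTriangles D T) (w : W) :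
    triangleLink T w ≤ skeleton (vertexLink D w) := fun _ _ h =>
  link_adj_iff.2 ⟨h.1, h.2.1, h.2.2.1, (hT _ h.2.2.2).1⟩

theorem IsTriangles.adj_of_triangleLink_adj (hT : IsTriangles D T) {w x y : W}
    (h : (triangleLink T w).Adj x y) :
    (graph D).Adj w x ∧ (graph D).Adj w y ∧ (graph D).Adj x y := by
  obtain ⟨hxy, hwx, hwy, hmem⟩ := h
  have hface := (hT _ hmem).1
  exact ⟨⟨hwx, _, hface, by simp, by simp⟩, ⟨hwy, _, hface, by simp, by simp⟩,
    ⟨hxy, _, hface, by simp, by simp⟩⟩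

theorem edgeDegree_le_two (hD : IsSurface D) (hT : IsTriangles D T) {e : Finset W} (he : #e = 2) :
    edgeDegree T e ≤ 2 := by
  obtain ⟨w, x, hwx, rfl⟩ := Finset.card_eq_two.1 he
  obtain ⟨y₁, y₂, hy⟩ := (hD w).elim (·.exists_two_neighbors x) (·.exists_two_neighbors x)
  refine (Finset.card_le_card (t := {{w, x, y₁}, {w, x, y₂}}) fun t ht => ?_).trans
    Finset.card_le_two
  rw [Finset.mem_filter] at ht
  obtain ⟨y, hwy, hxy, rfl⟩ := exists_eq_triple_of_pair_subset hwx (hT t ht.1).2 ht.2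
  rcases hy y (hT.triangleLink_le w ⟨hxy, hwx, hwy, ht.1⟩) with rfl | rfl <;> simp

theorem exists_triangleLink_adj (hT : IsTriangles D T) {w x : W} (hwx : w ≠ x)
    (he : 0 < edgeDegree T {w, x}) : ∃ y, (triangleLink T w).Adj x y := by
  obtain ⟨t, ht⟩ := Finset.card_pos.1 he
  rw [Finset.mem_filter] at ht
  obtain ⟨y, hwy, hxy, rfl⟩ := exists_eq_triple_of_pair_subset hwx (hT t ht.1).2 ht.2
  exact ⟨y, hxy, hwx, hwy, ht.1⟩

theorem exists_ne_triangleLink_adj (hT : IsTriangles D T) {w x y : W}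
    (he : Even (edgeDegree T {w, x})) (h : (triangleLink T w).Adj x y) :
    ∃ z ≠ y, (triangleLink T w).Adj x z := by
  obtain ⟨-, hwx, -, hmem⟩ := h
  have hmem' : ({w, x, y} : Finset W) ∈ ({t ∈ T | {w, x} ⊆ t} : Finset _) :=
    Finset.mem_filter.2 ⟨hmem, by grind⟩
  have hlt : 1 < edgeDegree T {w, x} := by
    have hpos : 0 < edgeDegree T {w, x} := Finset.card_pos.2 ⟨_, hmem'⟩
    grind
  obtain ⟨t, ht, hne⟩ := Finset.exists_mem_ne hlt {w, x, y}
  rw [Finset.mem_filter] at ht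
  obtain ⟨z, hwz, hxz, rfl⟩ := exists_eq_triple_of_pair_subset hwx (hT t ht.1).2 ht.2
  exact ⟨z, fun h => hne (by rw [h]), hxz, hwx, hwz, ht.1⟩

theorem isLeafless_triangleLink (hT : IsTriangles D T) {w : W}
    (he : ∀ x, w ≠ x → Even (edgeDegree T {w, x})) : IsLeafless (triangleLink T w) :=
  fun x _ h => exists_ne_triangleLink_adj hT (he x h.2.1) h

theorem degree_le_angle {w : W} (hw : IsInterior D w)
    (h : ∀ x y, (skeleton (vertexLink D w)).Adj x y → (triangleLink T w).Adj x y) :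
    degree D w ≤ angle T w := by
  obtain ⟨k, c, hc⟩ := hw
  have : NeZero k := ⟨by have := hc.1; lia⟩
  have hadj (i : ZMod k) : (triangleLink T w).Adj (c i) (c (i + 1)) :=
    h _ _ (hc.adj_iff.2 ⟨i, Or.inl ⟨rfl, rfl⟩⟩)
  have hinj : Function.Injective fun i => ({w, c i, c (i + 1)} : Finset W) := by
    intro i j hij
    have hnot (i : ZMod k) : w ∉ ({c i, c (i + 1)} : Finset W) := by
      simp [(hadj i).2.1, (hadj i).2.2.1]
    apply hc.injective_edge
    simpa only [Finset.erase_insert (hnot _)] using congrArg (Finset.erase · w) hij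
  calc degree D w = #(Finset.univ.image fun i => ({w, c i, c (i + 1)} : Finset W)) := by
        rw [hc.degree_eq, Finset.card_image_of_injective _ hinj, Finset.card_univ, ZMod.card]
    _ ≤ angle T w := Finset.card_le_card fun t ht => by
        obtain ⟨i, -, rfl⟩ := Finset.mem_image.1 ht
        simp [(hadj i).2.2.2]

theorem isInterior_and_degree_le_angle (hD : IsSurface D) (hT : IsTriangles D T) {w : W}
    (he : ∀ x, w ≠ x → Even (edgeDegree T {w, x})) (hw : ∃ t ∈ T, w ∈ t) :
    IsInterior D w ∧ degree D w ≤ angle T w := by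
  have hle := hT.triangleLink_le w
  have hleaf := isLeafless_triangleLink hT he
  have hne : triangleLink T w ≠ ⊥ := by
    obtain ⟨t, ht, hwt⟩ := hw
    obtain ⟨x, y, hwx, hwy, hxy, rfl⟩ := exists_eq_triple_of_mem (hT t ht).2 hwt
    exact SimpleGraph.ne_bot_iff_exists_adj.2 ⟨x, y, hxy, hwx, hwy, ht⟩
  have hint := (hD w).resolve_right fun h => hne (h.eq_bot_of_isLeafless hle hleaf)
  refine ⟨hint, degree_le_angle hint fun x y hxy => ?_⟩
  obtain ⟨k, c, hc⟩ := hint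
  obtain ⟨i, ⟨rfl, rfl⟩ | ⟨rfl, rfl⟩⟩ := hc.adj_iff.1 hxy
  exacts [hc.adj_of_isLeafless hle hleaf hne i, (hc.adj_of_isLeafless hle hleaf hne i).symm]

end Triangles

section Chains

variable {W : Type*}

/-- The chains with coefficients in `ZMod 2`; a one-chain vanishes on the sets that do not have two
elements. -/
abbrev Chain (W : Type*) : Type _ := Finset W → ZMod 2

theorem chain_add_self (f : Chain W) : f + f = 0 :=
  funext fun _ => CharTwo.add_self_eq_zero _

theorem chain_neg (f : Chain W) : -f = f :=
  neg_eq_of_add_eq_zero_left (chain_add_self f)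

variable [DecidableEq W] {D : AbstractSimplicialComplex W}

/-- The boundary of the triangle `t`. -/
def triangleBoundary (t : Finset W) : Chain W := fun e => if #e = 2 ∧ e ⊆ t then 1 else 0

/-- The boundary of the sum of the triangles of `T`. -/
def boundaryChain (T : Finset (Finset W)) : Chain W := ∑ t ∈ T, triangleBoundary t

/-- The edge `ab` as a chain, which is `0` if `a = b`. -/
def edgeChain (a b : W) : Chain W := if a = b then 0 else Pi.single {a, b} 1

theorem boundaryChain_apply (T : Finset (Finset W)) {e : Finset W} (he : #e = 2) :
    boundaryChain T e = edgeDegree T e := by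
  simp [boundaryChain, triangleBoundary, edgeDegree, he, Finset.sum_apply]

theorem boundaryChain_apply_of_card_ne (T : Finset (Finset W)) {e : Finset W} (he : #e ≠ 2) :
    boundaryChain T e = 0 := by
  simp [boundaryChain, triangleBoundary, he, Finset.sum_apply]

theorem edgeChain_self (a : W) : edgeChain a a = 0 :=
  if_pos rfl

theorem edgeChain_of_ne {a b : W} (hab : a ≠ b) : edgeChain a b = Pi.single {a, b} 1 :=
  if_neg hab

theorem edgeChain_comm (a b : W) : edgeChain a b = edgeChain b a := by
  simp only [edgeChain, Finset.pair_comm a b, eq_comm]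

theorem card_eq_two_and_subset_triple_iff {a b c : W} (hab : a ≠ b) (hbc : b ≠ c) (hac : a ≠ c)
    {e : Finset W} : #e = 2 ∧ e ⊆ {a, b, c} ↔ e = {a, b} ∨ e = {b, c} ∨ e = {a, c} := by
  constructor
  · rintro ⟨he, hsub⟩
    obtain ⟨x, y, hxy, rfl⟩ := Finset.card_eq_two.1 he
    have hx := hsub (by simp : x ∈ ({x, y} : Finset W))
    have hy := hsub (by simp : y ∈ ({x, y} : Finset W))
    grind
  · rintro (rfl | rfl | rfl)
    exacts [⟨Finset.card_pair hab, by grind⟩, ⟨Finset.card_pair hbc, by grind⟩,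
      ⟨Finset.card_pair hac, by grind⟩]

theorem edgeChain_add_add {a b c : W} (hab : a ≠ b) (hbc : b ≠ c) (hac : a ≠ c) :
    edgeChain a b + edgeChain b c + edgeChain a c = triangleBoundary {a, b, c} := by
  ext e
  have h₁ : ({a, b} : Finset W) ≠ {b, c} :=
    ne_of_mem_of_not_mem' (a := a) (by simp) (by grind)
  have h₂ : ({a, b} : Finset W) ≠ {a, c} :=
    ne_of_mem_of_not_mem' (a := b) (by simp) (by grind)
  have h₃ : ({b, c} : Finset W) ≠ {a, c} :=
    ne_of_mem_of_not_mem' (a := b) (by simp) (by grind)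
  simp only [edgeChain_of_ne, hab, hbc, hac, ne_eq, not_false_eq_true, Pi.add_apply,
    triangleBoundary, Pi.single_apply, card_eq_two_and_subset_triple_iff]
  split_ifs <;> simp_all

theorem boundaryChain_sdiff_add_inter (S T : Finset (Finset W)) :
    boundaryChain (S \ T) + boundaryChain (S ∩ T) = boundaryChain S := by
  rw [boundaryChain, boundaryChain, ← Finset.sum_union (Finset.disjoint_sdiff_inter S T),
    Finset.sdiff_union_inter, boundaryChain]

theorem boundaryChain_symmDiff (S T : Finset (Finset W)) :
    boundaryChain (symmDiff S T) = boundaryChain S + boundaryChain T := by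
  have hunion : boundaryChain (symmDiff S T) = boundaryChain (S \ T) + boundaryChain (T \ S) :=
    Finset.sum_union disjoint_sdiff_sdiff
  rw [hunion, ← boundaryChain_sdiff_add_inter S T, ← boundaryChain_sdiff_add_inter T S,
    Finset.inter_comm T S, add_add_add_comm, chain_add_self, add_zero]

variable (D) in
/-- The group of boundaries of two-chains of `D`. -/
def boundaries : AddSubgroup (Chain W) where
  carrier := {f | ∃ T, IsTriangles D T ∧ boundaryChain T = f}
  zero_mem' := ⟨∅, by simp [IsTriangles], Finset.sum_empty⟩
  add_mem' := by
    rintro _ _ ⟨S, hS, rfl⟩ ⟨T, hT, rfl⟩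
    refine ⟨symmDiff S T, fun t ht => ?_, boundaryChain_symmDiff S T⟩
    exact (Finset.mem_symmDiff.1 ht).elim (hS t ·.1) (hT t ·.1)
  neg_mem' := by
    rintro f hf
    rwa [chain_neg]

theorem triangleBoundary_mem_boundaries {t : Finset W} (ht : t ∈ D.faces) (ht' : #t = 3) :
    triangleBoundary t ∈ boundaries D :=
  ⟨{t}, fun s hs => by rw [Finset.mem_singleton.1 hs]; exact ⟨ht, ht'⟩, Finset.sum_singleton _ _⟩

theorem edgeChain_add_add_mem_boundaries {a b c : W} {σ : Finset W} (hσ : σ ∈ D.faces)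
    (ha : a ∈ σ) (hb : b ∈ σ) (hc : c ∈ σ) :
    edgeChain a b + edgeChain b c + edgeChain a c ∈ boundaries D := by
  obtain rfl | hab := eq_or_ne a b
  · rw [edgeChain_self, zero_add, chain_add_self]
    exact zero_mem _
  obtain rfl | hbc := eq_or_ne b c
  · rw [edgeChain_self, add_zero, chain_add_self]
    exact zero_mem _
  obtain rfl | hac := eq_or_ne a c
  · rw [edgeChain_self, add_zero, edgeChain_comm, chain_add_self]
    exact zero_mem _
  rw [edgeChain_add_add hab hbc hac]
  refine triangleBoundary_mem_boundaries ((D.isRelLowerSet_faces hσ).2 ?_ (by simp))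
    (Finset.card_eq_three.2 ⟨a, b, c, hab, hac, hbc, rfl⟩)
  simp [Finset.insert_subset_iff, ha, hb, hc]

end Chains

section Paths

variable {W : Type*} [DecidableEq W] {D : AbstractSimplicialComplex W}

/-- The sum of the edges of an edge path, given as the list of its vertices. -/
def listChain : List W → Chain W
  | [] => 0
  | [_] => 0
  | a :: b :: l => edgeChain a b + listChain (b :: l)

/-- The sum of the edges of a walk. -/
def walkChain {G : SimpleGraph W} {a b : W} (p : G.Walk a b) : Chain W :=
  (p.darts.map fun d => edgeChain d.fst d.snd).sum

theorem listChain_append (l₁ l₂ : List W) (a : W) :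
    listChain (l₁ ++ a :: l₂) = listChain (l₁ ++ [a]) + listChain (a :: l₂) := by
  induction l₁ with
  | nil => simp [listChain]
  | cons b l ih =>
    cases l with
    | nil => simp [listChain]
    | cons c l =>
      simp only [List.cons_append, listChain] at ih ⊢
      rw [ih, add_assoc]

theorem EdgeMove.listChain_sub_mem {l₁ l₂ : List W}
    (h : EdgeMove D.toPreAbstractSimplicialComplex l₁ l₂) :
    listChain l₁ - listChain l₂ ∈ boundaries D := by
  obtain ⟨l₁, l₂, a, b, c, σ, hσ, ha, hb, hc⟩ := h
  convert edgeChain_add_add_mem_boundaries hσ ha hb hc using 1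
  rw [listChain_append l₁ (b :: c :: l₂) a, listChain_append l₁ (c :: l₂) a]
  simp only [listChain]
  linear_combination chain_neg (edgeChain a c)

theorem listChain_sub_mem_of_eqvGen {l₁ l₂ : List W}
    (h : Relation.EqvGen (EdgeMove D.toPreAbstractSimplicialComplex) l₁ l₂) :
    listChain l₁ - listChain l₂ ∈ boundaries D := by
  induction h with
  | rel _ _ h => exact h.listChain_sub_mem
  | refl => rw [sub_self]; exact zero_mem _
  | symm _ _ _ ih => rw [← neg_sub]; exact neg_mem ih
  | trans _ _ _ _ _ ih₁ ih₂ => rw [← sub_add_sub_cancel]; exact add_mem ih₁ ih₂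

theorem listChain_support {G : SimpleGraph W} {a b : W} (p : G.Walk a b) :
    listChain p.support = walkChain p := by
  induction p with
  | nil => simp [listChain, walkChain]
  | cons h p ih =>
    cases p with
    | nil => simp [listChain, walkChain]
    | cons h' p =>
      simp only [walkChain, SimpleGraph.Walk.support_cons, SimpleGraph.Walk.darts_cons,
        List.map_cons, List.sum_cons, listChain] at ih ⊢
      rw [ih]

theorem walkChain_append {G : SimpleGraph W} {a b c : W} (p : G.Walk a b) (q : G.Walk b c) :
    walkChain (p.append q) = walkChain p + walkChain q := by
  simp [walkChain]

theorem walkChain_reverse {G : SimpleGraph W} {a b : W} (p : G.Walk a b) :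
    walkChain p.reverse = walkChain p := by
  simp only [walkChain, SimpleGraph.Walk.darts_reverse, List.map_reverse, List.sum_reverse,
    List.map_map]
  congr 2
  exact funext fun d => edgeChain_comm _ _

theorem walkChain_cons {G : SimpleGraph W} {a b c : W} (h : G.Adj a b) (p : G.Walk b c) :
    walkChain (.cons h p) = edgeChain a b + walkChain p := by
  simp [walkChain]

theorem walkChain_mem_boundaries (hD : IsSimplyConnected D) {a : W} (p : (graph D).Walk a a) :
    walkChain p ∈ boundaries D := by
  rw [← listChain_support]
  have hchain : p.support.IsChain (Joined D.toPreAbstractSimplicialComplex) :=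
    p.isChain_adj_support.imp fun _ _ h => h.2
  cases p with
  | nil => exact zero_mem _
  | cons h p =>
    rw [SimpleGraph.Walk.support_cons] at hchain ⊢
    have hlast : p.support = p.support.dropLast ++ [a] := by
      have := List.dropLast_append_getLast (SimpleGraph.Walk.support_ne_nil p)
      rw [SimpleGraph.Walk.getLast_support] at this
      exact this.symm
    rw [hlast] at hchain ⊢
    simpa [listChain, edgeChain] using
      listChain_sub_mem_of_eqvGen (hD.closed_path a _ hchain)

end Paths

section OneCycles

variable {W : Type*} [Fintype W] [DecidableEq W] {D : AbstractSimplicialComplex W}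

/-- `f` has zero boundary: every vertex lies on an even number of edges of `f`. -/
def IsClosedChain (f : Chain W) : Prop := ∀ w, ∑ e with w ∈ e, f e = 0

theorem IsClosedChain.eq_sum {f : Chain W} (hf : IsClosedChain f) (g : W → Chain W) :
    f = ∑ e, f e • (Pi.single e 1 + ∑ w ∈ e, g w) := by
  have hsingle : ∑ e, f e • (Pi.single e 1 : Chain W) = f := by
    ext e
    simp [Finset.sum_apply, Pi.single_apply]
  have hzero : ∑ e, f e • ∑ w ∈ e, g w = 0 := by
    calc ∑ e, f e • ∑ w ∈ e, g w = ∑ e : Finset W, ∑ w, if w ∈ e then f e • g w else 0 := by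
          simp [Finset.smul_sum]
      _ = ∑ w, (∑ e with w ∈ e, f e) • g w := by
          rw [Finset.sum_comm]
          simp only [← Finset.sum_filter, Finset.sum_smul]
      _ = 0 := Finset.sum_eq_zero fun w _ => by rw [hf w, zero_smul]
  simp_rw [smul_add, Finset.sum_add_distrib]
  rw [hsingle, hzero, add_zero]

/-- Coning off to a base vertex `v`: each edge `ab` of `f` is completed to a closed walk by walks
from `v` to `a` and `b`, and these walks cancel out in the sum because `f` is closed. -/
theorem IsClosedChain.mem_boundaries (hD : IsSimplyConnected D) {f : Chain W}
    (hf : IsClosedChain f) (hfD : ∀ e, f e ≠ 0 → e ∈ D.faces ∧ #e = 2) : f ∈ boundaries D := by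
  obtain ⟨v⟩ := hD.connected.nonempty
  let p (w : W) : (graph D).Walk v w := (hD.connected.preconnected v w).some
  rw [hf.eq_sum fun w => walkChain (p w)]
  refine sum_mem fun e _ => ?_
  by_cases he : f e = 0
  · rw [he, zero_smul]
    exact zero_mem _
  obtain ⟨a, b, hab, rfl⟩ := Finset.card_eq_two.1 (hfD e he).2
  have hadj : (graph D).Adj a b := skeleton_adj_iff.2 ⟨hab, (hfD _ he).1⟩
  have hclosed := walkChain_mem_boundaries hD ((p a).append (.cons hadj (p b).reverse))
  have hone : f {a, b} = 1 := Fin.eq_one_of_ne_zero _ he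
  rw [hone, one_smul, Finset.sum_pair hab]
  rw [walkChain_append, walkChain_cons, walkChain_reverse, edgeChain_of_ne hab] at hclosed
  rwa [add_left_comm]

theorem isClosedChain_triangleBoundary {t : Finset W} (ht : #t = 3) :
    IsClosedChain (triangleBoundary t) := by
  intro w
  obtain ⟨a, b, c, hab, hac, hbc, rfl⟩ := Finset.card_eq_three.1 ht
  rw [← edgeChain_add_add hab hbc hac]
  simp only [edgeChain_of_ne, ne_eq, hab, hbc, hac, not_false_eq_true, Pi.add_apply,
    Finset.sum_add_distrib, Pi.single_apply, Finset.sum_ite_eq', Finset.mem_filter,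
    Finset.mem_univ, true_and, Finset.mem_insert, Finset.mem_singleton]
  have h2 : (1 : ZMod 2) + 1 = 0 := by decide
  grind

theorem isClosedChain_boundaryChain {T : Finset (Finset W)} (hT : IsTriangles D T) :
    IsClosedChain (boundaryChain T) := by
  intro w
  simp only [boundaryChain, Finset.sum_apply]
  rw [Finset.sum_comm]
  exact Finset.sum_eq_zero fun t ht => isClosedChain_triangleBoundary (hT t ht).2 w

end OneCycles

section Polygons

variable {W : Type*} {D : AbstractSimplicialComplex W} {N : ℕ} {c : ℕ → W}

/-- `c 0, …, c N` is a simple closed edge path. -/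
structure IsPolygon (D : AbstractSimplicialComplex W) (N : ℕ) (c : ℕ → W) : Prop where
  three_le : 3 ≤ N
  closed : c N = c 0
  injOn : Set.InjOn c (Set.Iio N)
  adj : ∀ i < N, (graph D).Adj (c i) (c (i + 1))

theorem IsPolygon.eq_or_of_apply_eq (h : IsPolygon D N c) {i j : ℕ} (hi : i ≤ N) (hj : j ≤ N)
    (hij : c i = c j) : i = j ∨ (i = 0 ∧ j = N) ∨ (i = N ∧ j = 0) := by
  have hN := h.three_le
  have hinj {i j : ℕ} (hi : i < N) (hj : j < N) (hij : c i = c j) : i = j := h.injOn hi hj hij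
  rcases hi.lt_or_eq with hi | rfl <;> rcases hj.lt_or_eq with hj | rfl
  · exact Or.inl (hinj hi hj hij)
  · have := hinj hi (by lia) (hij.trans h.closed)
    lia
  · have := hinj (by lia) hj (h.closed.symm.trans hij)
    lia
  · exact Or.inl rfl

variable [DecidableEq W]

/-- The sum of the edges of the edge path `c 0, …, c N`. -/
def pathChain (c : ℕ → W) (N : ℕ) : Chain W :=
  ∑ i ∈ Finset.range N, edgeChain (c i) (c (i + 1))

/-- The edges of the edge path `c 0, …, c N`. -/
def pathEdges (c : ℕ → W) (N : ℕ) : Finset (Finset W) :=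
  (Finset.range N).image fun i => {c i, c (i + 1)}

theorem mem_pathEdges {e : Finset W} : e ∈ pathEdges c N ↔ ∃ i < N, {c i, c (i + 1)} = e := by
  simp [pathEdges]

theorem mem_pathEdges_of_pathChain_ne_zero {e : Finset W} (he : pathChain c N e ≠ 0) :
    e ∈ pathEdges c N := by
  rw [pathChain, Finset.sum_apply] at he
  obtain ⟨i, hi, hne⟩ := Finset.exists_ne_zero_of_sum_ne_zero he
  refine mem_pathEdges.2 ⟨i, Finset.mem_range.1 hi, ?_⟩
  by_contra hei
  rw [edgeChain] at hne
  split_ifs at hne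
  exacts [hne rfl, hne (Pi.single_eq_of_ne' hei _)]

theorem mem_faces_and_card_of_mem_pathEdges (hadj : ∀ i < N, (graph D).Adj (c i) (c (i + 1)))
    {e : Finset W} (he : e ∈ pathEdges c N) : e ∈ D.faces ∧ #e = 2 := by
  obtain ⟨i, hi, rfl⟩ := mem_pathEdges.1 he
  obtain ⟨hne, hmem⟩ := skeleton_adj_iff.1 (hadj i hi)
  exact ⟨hmem, Finset.card_pair hne⟩

theorem sum_edgeChain [Fintype W] (w : W) {a b : W} (hab : a ≠ b) :
    ∑ e with w ∈ e, edgeChain a b e = (if w = a then 1 else 0) + (if w = b then 1 else 0) := by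
  simp only [edgeChain_of_ne hab, Pi.single_apply, Finset.sum_ite_eq', Finset.mem_filter,
    Finset.mem_univ, true_and, Finset.mem_insert, Finset.mem_singleton]
  obtain rfl | h := eq_or_ne w a
  · simp [hab]
  · simp [h]

theorem sum_pathChain [Fintype W] (hadj : ∀ i < N, (graph D).Adj (c i) (c (i + 1))) (w : W) :
    ∑ e with w ∈ e, pathChain c N e =
      (if w = c 0 then 1 else 0) + (if w = c N then 1 else 0) := by
  induction N with
  | zero => simp [pathChain, CharTwo.add_self_eq_zero]
  | succ N ih =>
    have hsucc : pathChain c (N + 1) = pathChain c N + edgeChain (c N) (c (N + 1)) :=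
      Finset.sum_range_succ _ _
    simp only [hsucc, Pi.add_apply, Finset.sum_add_distrib]
    rw [ih fun i hi => hadj i (hi.trans N.lt_succ_self), sum_edgeChain w (hadj N N.lt_succ_self).1]
    linear_combination CharTwo.add_self_eq_zero (if w = c N then (1 : ZMod 2) else 0)

theorem pathChain_mem_boundaries [Finite W] (hD : IsSimplyConnected D)
    (hadj : ∀ i < N, (graph D).Adj (c i) (c (i + 1))) (hc : c N = c 0) :
    pathChain c N ∈ boundaries D := by
  have := Fintype.ofFinite W
  refine IsClosedChain.mem_boundaries hD (fun w => ?_) fun e he =>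
    mem_faces_and_card_of_mem_pathEdges hadj (mem_pathEdges_of_pathChain_ne_zero he)
  rw [sum_pathChain hadj, hc, CharTwo.add_self_eq_zero]

namespace IsPolygon

theorem injOn_edge (h : IsPolygon D N c) :
    Set.InjOn (fun i => ({c i, c (i + 1)} : Finset W)) (Set.Iio N) := by
  have hN := h.three_le
  intro i hi j hj hij
  rw [Set.mem_Iio] at hi hj
  have hij' : ({c i, c (i + 1)} : Set W) = {c j, c (j + 1)} := by
    simpa using congrArg (fun s : Finset W => (s : Set W)) hij
  rcases Set.pair_eq_pair_iff.1 hij' with ⟨h₁, -⟩ | ⟨h₁, h₂⟩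
  · exact h.injOn hi hj h₁
  · have := h.eq_or_of_apply_eq hi.le hj h₁
    have := h.eq_or_of_apply_eq hi hj.le h₂
    lia

theorem card_pathEdges (h : IsPolygon D N c) : #(pathEdges c N) = N := by
  rw [pathEdges, Finset.card_image_of_injOn (by simpa using h.injOn_edge), Finset.card_range]

theorem pathChain_apply (h : IsPolygon D N c) (e : Finset W) :
    pathChain c N e = if e ∈ pathEdges c N then 1 else 0 := by
  calc pathChain c N e = ∑ i ∈ Finset.range N, if {c i, c (i + 1)} = e then 1 else 0 := by
        rw [pathChain, Finset.sum_apply]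
        refine Finset.sum_congr rfl fun i hi => ?_
        rw [edgeChain_of_ne (h.adj i (Finset.mem_range.1 hi)).1, Pi.single_apply]
        simp only [eq_comm]
    _ = ∑ e' ∈ pathEdges c N, if e' = e then 1 else 0 := by
        rw [pathEdges, Finset.sum_image (by simpa using h.injOn_edge)]
    _ = if e ∈ pathEdges c N then 1 else 0 := Finset.sum_ite_eq' _ _ _

theorem eq_or_eq_of_mem_pathEdges (h : IsPolygon D N c) {i : ℕ} (hi : i + 1 < N) {e : Finset W}
    (he : e ∈ pathEdges c N) (hmem : c (i + 1) ∈ e) :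
    e = {c i, c (i + 1)} ∨ e = {c (i + 1), c (i + 2)} := by
  obtain ⟨j, hj, rfl⟩ := mem_pathEdges.1 he
  rw [Finset.mem_insert, Finset.mem_singleton] at hmem
  rcases hmem with hmem | hmem
  · have := h.eq_or_of_apply_eq hi.le hj.le hmem
    obtain rfl : i + 1 = j := by lia
    exact Or.inr rfl
  · have := h.eq_or_of_apply_eq hi.le hj hmem
    obtain rfl : i = j := by lia
    exact Or.inl rfl

theorem closedChain_apply_edge [Fintype W] (h : IsPolygon D N c) {f : Chain W}
    (hf : IsClosedChain f) (hfc : ∀ e, f e ≠ 0 → e ∈ pathEdges c N) {i : ℕ} (hi : i < N) :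
    f {c i, c (i + 1)} = f {c 0, c 1} := by
  induction i with
  | zero => rfl
  | succ i ih =>
    rw [← ih (by lia)]
    have hne : ({c i, c (i + 1)} : Finset W) ≠ {c (i + 1), c (i + 2)} := fun heq => by
      have := h.injOn_edge (Set.mem_Iio.2 (by lia)) (Set.mem_Iio.2 hi) heq
      lia
    have hsum : ∑ e ∈ {{c i, c (i + 1)}, {c (i + 1), c (i + 2)}}, f e = 0 := by
      rw [← hf (c (i + 1))]
      refine Finset.sum_subset (fun e he => ?_) fun e he₁ he₂ => ?_
      · rw [Finset.mem_insert, Finset.mem_singleton] at he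
        rcases he with rfl | rfl <;> simp
      · by_contra hfe
        refine he₂ ?_
        rw [Finset.mem_insert, Finset.mem_singleton]
        exact h.eq_or_eq_of_mem_pathEdges hi (hfc e hfe) (Finset.mem_filter.1 he₁).2
    rw [Finset.sum_pair hne] at hsum
    exact (CharTwo.add_eq_zero.1 hsum).symm

theorem closedChain_eq_zero_or_eq [Fintype W] (h : IsPolygon D N c) {f : Chain W}
    (hf : IsClosedChain f) (hfc : ∀ e, f e ≠ 0 → e ∈ pathEdges c N) :
    f = 0 ∨ f = pathChain c N := by
  have hconst (e : Finset W) : f e = if e ∈ pathEdges c N then f {c 0, c 1} else 0 := by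
    split_ifs with he
    · obtain ⟨i, hi, rfl⟩ := mem_pathEdges.1 he
      exact h.closedChain_apply_edge hf hfc hi
    · exact of_not_not (mt (hfc e) he)
  by_cases hzero : f {c 0, c 1} = 0
  · exact Or.inl (funext fun e => by rw [hconst, hzero, ite_self, Pi.zero_apply])
  · have hone : f {c 0, c 1} = 1 := Fin.eq_one_of_ne_zero _ hzero
    exact Or.inr (funext fun e => by rw [hconst, hone, h.pathChain_apply])

end IsPolygon

end Polygons

section Incidences

theorem finrank_add_one_le {k A B C : Type*} [Field k] [AddCommGroup A] [Module k A]
    [AddCommGroup B] [Module k B] [AddCommGroup C] [Module k C] [FiniteDimensional k A]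
    [FiniteDimensional k B] [FiniteDimensional k C] {f : A →ₗ[k] B} {g : B →ₗ[k] C}
    (hker : LinearMap.ker g ≤ LinearMap.range f) (hrange : LinearMap.range g ≠ ⊤) :
    Module.finrank k B + 1 ≤ Module.finrank k A + Module.finrank k C := by
  calc Module.finrank k B + 1
      = Module.finrank k (LinearMap.range g) + Module.finrank k (LinearMap.ker g) + 1 := by
        rw [g.finrank_range_add_finrank_ker]
    _ ≤ Module.finrank k (LinearMap.range g) + Module.finrank k A + 1 := by
        gcongr
        exact (Submodule.finrank_mono hker).trans f.finrank_range_le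
    _ ≤ Module.finrank k A + Module.finrank k C := by
        have := Submodule.finrank_lt hrange
        lia


variable {W : Type*} [DecidableEq W] {D : AbstractSimplicialComplex W} {T : Finset (Finset W)}

/-- The edges of the triangles of `T`. -/
def edgesOf (T : Finset (Finset W)) : Finset (Finset W) := T.biUnion (Finset.powersetCard 2)

/-- The vertices of the triangles of `T`. -/
def verticesOf (T : Finset (Finset W)) : Finset W := T.biUnion id

theorem mem_edgesOf {e : Finset W} : e ∈ edgesOf T ↔ #e = 2 ∧ ∃ t ∈ T, e ⊆ t := by
  simp only [edgesOf, Finset.mem_biUnion, Finset.mem_powersetCard]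
  grind

theorem mem_verticesOf {w : W} : w ∈ verticesOf T ↔ ∃ t ∈ T, w ∈ t := by
  simp [verticesOf]

theorem mem_edgesOf_iff_edgeDegree_pos {e : Finset W} (he : #e = 2) :
    e ∈ edgesOf T ↔ 0 < edgeDegree T e := by
  rw [mem_edgesOf, edgeDegree, Finset.card_pos, Finset.filter_nonempty_iff]
  exact and_iff_right he

theorem mem_verticesOf_of_mem_edgesOf {e : Finset W} (he : e ∈ edgesOf T) {w : W} (hw : w ∈ e) :
    w ∈ verticesOf T := by
  obtain ⟨-, t, ht, hsub⟩ := mem_edgesOf.1 he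
  exact mem_verticesOf.2 ⟨t, ht, hsub hw⟩

theorem edgeDegree_mono {S : Finset (Finset W)} (h : S ⊆ T) (e : Finset W) :
    edgeDegree S e ≤ edgeDegree T e :=
  Finset.card_le_card (Finset.filter_subset_filter _ h)

theorem edgeDegree_sdiff_add (S T : Finset (Finset W)) (e : Finset W) :
    edgeDegree (S \ T) e + edgeDegree T e = edgeDegree (S ∪ T) e := by
  rw [edgeDegree, edgeDegree, edgeDegree, ← Finset.sdiff_union_self_eq_union, Finset.filter_union,
    Finset.card_union_of_disjoint (Finset.disjoint_filter_filter Finset.sdiff_disjoint)]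

theorem sum_edgeDegree (hT : IsTriangles D T) : ∑ e ∈ edgesOf T, edgeDegree T e = 3 * #T := by
  calc ∑ e ∈ edgesOf T, edgeDegree T e = ∑ t ∈ T, #{e ∈ edgesOf T | e ⊆ t} :=
        Finset.sum_card_bipartiteAbove_eq_sum_card_bipartiteBelow _
    _ = ∑ t ∈ T, 3 := Finset.sum_congr rfl fun t ht => by
        have : ({e ∈ edgesOf T | e ⊆ t} : Finset _) = t.powersetCard 2 := by
          ext e
          rw [Finset.mem_filter, mem_edgesOf, Finset.mem_powersetCard]
          exact ⟨fun h => ⟨h.2, h.1.1⟩, fun h => ⟨⟨h.2, t, ht, h.1⟩, h.1⟩⟩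
        rw [this, Finset.card_powersetCard, (hT t ht).2]
        rfl
    _ = 3 * #T := by rw [Finset.sum_const, smul_eq_mul, mul_comm]

theorem sum_angle (hT : IsTriangles D T) : ∑ w ∈ verticesOf T, angle T w = 3 * #T := by
  calc ∑ w ∈ verticesOf T, angle T w = ∑ t ∈ T, #{w ∈ verticesOf T | w ∈ t} :=
        Finset.sum_card_bipartiteAbove_eq_sum_card_bipartiteBelow _
    _ = ∑ t ∈ T, 3 := Finset.sum_congr rfl fun t ht => by
        rw [Finset.filter_mem_eq_inter, Finset.inter_eq_right.2 fun w hw =>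
          mem_verticesOf.2 ⟨t, ht, hw⟩, (hT t ht).2]
    _ = 3 * #T := by rw [Finset.sum_const, smul_eq_mul, mul_comm]

variable (T) in
/-- The boundary operator from two-chains to one-chains of the complex generated by `T`. -/
def edgeTriangleMatrix : Matrix (edgesOf T) T (ZMod 2) :=
  Matrix.of fun e t => if e.1 ⊆ t.1 then 1 else 0

variable (T) in
/-- The boundary operator from one-chains to zero-chains of the complex generated by `T`. -/
def vertexEdgeMatrix : Matrix (verticesOf T) (edgesOf T) (ZMod 2) :=
  Matrix.of fun w e => if w.1 ∈ e.1 then 1 else 0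

theorem edgeTriangleMatrix_mulVec_apply {S : Finset (Finset W)} (h : S ⊆ T) (e : edgesOf T) :
    (edgeTriangleMatrix T).mulVec (fun t => if t.1 ∈ S then 1 else 0) e = boundaryChain S e := by
  have hcard := (mem_edgesOf.1 e.2).1
  simp only [boundaryChain, Finset.sum_apply, triangleBoundary, hcard, true_and, Matrix.mulVec,
    dotProduct, edgeTriangleMatrix, Matrix.of_apply, mul_ite, mul_one, mul_zero]
  rw [Finset.sum_coe_sort T fun t => if t ∈ S then if e.1 ⊆ t then (1 : ZMod 2) else 0 else 0,
    ← Finset.sum_filter, Finset.filter_mem_eq_inter, Finset.inter_eq_right.2 h]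

theorem vertexEdgeMatrix_mulVec_apply [Fintype W] {f : Chain W}
    (hf : ∀ e, f e ≠ 0 → e ∈ edgesOf T) (w : verticesOf T) :
    (vertexEdgeMatrix T).mulVec (fun e => f e) w = ∑ e with w.1 ∈ e, f e := by
  simp only [Matrix.mulVec, dotProduct, vertexEdgeMatrix, Matrix.of_apply, ite_mul, one_mul,
    zero_mul]
  rw [Finset.sum_coe_sort (edgesOf T) fun e => if w.1 ∈ e then f e else 0, Finset.sum_filter]
  refine Finset.sum_subset (Finset.subset_univ _) fun e _ he => ?_
  rw [of_not_not (mt (hf e) he), ite_self]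

theorem sum_vertexEdgeMatrix_mulVec (x : edgesOf T → ZMod 2) :
    ∑ w, (vertexEdgeMatrix T).mulVec x w = 0 := by
  have hcol (e : edgesOf T) : ∑ w, vertexEdgeMatrix T w e = 0 := by
    simp only [vertexEdgeMatrix, Matrix.of_apply]
    rw [Finset.sum_coe_sort (verticesOf T) fun w => if w ∈ e.1 then (1 : ZMod 2) else 0,
      Finset.sum_boole, Finset.filter_mem_eq_inter,
      Finset.inter_eq_right.2 fun w => mem_verticesOf_of_mem_edgesOf e.2, (mem_edgesOf.1 e.2).1]
    rfl
  simp only [Matrix.mulVec, dotProduct]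
  rw [Finset.sum_comm]
  simp_rw [← Finset.sum_mul, hcol, zero_mul, Finset.sum_const_zero]

theorem range_vertexEdgeMatrix_ne_top (h : (verticesOf T).Nonempty) :
    LinearMap.range (vertexEdgeMatrix T).mulVecLin ≠ ⊤ := by
  intro htop
  obtain ⟨w, hw⟩ := h
  obtain ⟨x, hx⟩ := LinearMap.range_eq_top.1 htop (Pi.single ⟨w, hw⟩ 1)
  have hsum := sum_vertexEdgeMatrix_mulVec x
  rw [← Matrix.mulVecLin_apply, hx, Finset.sum_pi_single'] at hsum
  simp at hsum

end Incidences

section FilledPolygons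

variable {W : Type*} [DecidableEq W] {D : AbstractSimplicialComplex W} {N : ℕ} {c : ℕ → W}
  {T : Finset (Finset W)}

/-- The triangles of `T` fill the simple closed edge path `c 0, …, c N` modulo `2`. -/
structure IsFilledPolygon (D : AbstractSimplicialComplex W) (N : ℕ) (c : ℕ → W)
    (T : Finset (Finset W)) : Prop extends IsPolygon D N c where
  isTriangles : IsTriangles D T
  boundaryChain_eq : boundaryChain T = pathChain c N

namespace IsFilledPolygon

theorem edgeDegree_cast (h : IsFilledPolygon D N c T) {e : Finset W} (he : #e = 2) :
    (edgeDegree T e : ZMod 2) = if e ∈ pathEdges c N then 1 else 0 := by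
  rw [← boundaryChain_apply T he, h.boundaryChain_eq, h.pathChain_apply]

theorem even_edgeDegree_iff (h : IsFilledPolygon D N c T) {e : Finset W} (he : #e = 2) :
    Even (edgeDegree T e) ↔ e ∉ pathEdges c N := by
  rw [← ZMod.natCast_eq_zero_iff_even, h.edgeDegree_cast he]
  simp

theorem pathEdges_subset_edgesOf (h : IsFilledPolygon D N c T) : pathEdges c N ⊆ edgesOf T := by
  intro e he
  have hcard := (mem_faces_and_card_of_mem_pathEdges h.adj he).2
  rw [mem_edgesOf_iff_edgeDegree_pos hcard]
  exact (Nat.not_even_iff_odd.1 fun heven => (h.even_edgeDegree_iff hcard).1 heven he).pos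

theorem mem_pathEdges_of_boundaryChain_sdiff_ne_zero (hD : IsSurface D)
    (h : IsFilledPolygon D N c T) {S : Finset (Finset W)} (hS : IsTriangles D S)
    (hST : ∀ e, boundaryChain S e ≠ 0 → e ∈ edgesOf T) {e : Finset W}
    (he : boundaryChain (S \ T) e ≠ 0) : e ∈ pathEdges c N := by
  have hcard : #e = 2 := by
    by_contra hcard
    exact he (boundaryChain_apply_of_card_ne _ hcard)
  by_contra hpath
  have hle : edgeDegree (S ∪ T) e ≤ 2 := edgeDegree_le_two hD
    (fun t ht => (Finset.mem_union.1 ht).elim (hS t) (h.isTriangles t)) hcard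
  have hadd := edgeDegree_sdiff_add S T e
  have heven := (h.even_edgeDegree_iff hcard).2 hpath
  rw [boundaryChain_apply _ hcard, ne_eq, ZMod.natCast_eq_zero_iff_even] at he
  have hzero : edgeDegree T e = 0 := by grind
  have hSeven : Even (edgeDegree S e) := by
    rw [← ZMod.natCast_eq_zero_iff_even, ← boundaryChain_apply S hcard]
    by_contra hne
    exact ((mem_edgesOf_iff_edgeDegree_pos hcard).1 (hST e hne)).ne' hzero
  have h₁ := edgeDegree_mono (Finset.sdiff_subset (s := S) (t := T)) e
  have h₂ := edgeDegree_mono (Finset.subset_union_left (s₁ := S) (s₂ := T)) e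
  obtain heq : edgeDegree S e = edgeDegree (S \ T) e := by lia
  exact he (heq ▸ hSeven)

theorem exists_subset_boundaryChain_eq [Fintype W] (hD : IsDisc D) (h : IsFilledPolygon D N c T)
    {f : Chain W} (hf : IsClosedChain f) (hfT : ∀ e, f e ≠ 0 → e ∈ edgesOf T) :
    ∃ S ⊆ T, boundaryChain S = f := by
  obtain ⟨S, hS, rfl⟩ := hf.mem_boundaries hD.simplyConnected fun e he => by
    obtain ⟨hcard, t, ht, hsub⟩ := mem_edgesOf.1 (hfT e he)
    exact ⟨(D.isRelLowerSet_faces (h.isTriangles t ht).1).2 hsub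
      (Finset.card_pos.1 (by lia)), hcard⟩
  have hsdiff : IsTriangles D (S \ T) := fun t ht => hS t (Finset.mem_sdiff.1 ht).1
  have hST := boundaryChain_sdiff_add_inter S T
  have hTS := boundaryChain_sdiff_add_inter T S
  rcases h.closedChain_eq_zero_or_eq (isClosedChain_boundaryChain hsdiff) fun e =>
    h.mem_pathEdges_of_boundaryChain_sdiff_ne_zero hD.surface hS hfT with hzero | hpath
  · exact ⟨S ∩ T, Finset.inter_subset_right, by rw [← hST, hzero, zero_add]⟩
  · refine ⟨T \ S, Finset.sdiff_subset, ?_⟩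
    rw [h.boundaryChain_eq, ← hpath, Finset.inter_comm] at hTS
    linear_combination hTS + hST - chain_add_self (boundaryChain (S ∩ T))

theorem ker_vertexEdgeMatrix_le [Finite W] (hD : IsDisc D) (h : IsFilledPolygon D N c T) :
    LinearMap.ker (vertexEdgeMatrix T).mulVecLin ≤
      LinearMap.range (edgeTriangleMatrix T).mulVecLin := by
  have := Fintype.ofFinite W
  intro x hx
  let f : Chain W := Function.extend Subtype.val x 0
  have hfx : (fun e : edgesOf T => f e) = x :=
    funext fun e => Subtype.val_injective.extend_apply x 0 e
  have hfT (e : Finset W) (he : f e ≠ 0) : e ∈ edgesOf T := by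
    by_contra hmem
    exact he (Function.extend_apply' _ _ _ (by rintro ⟨e, rfl⟩; exact hmem e.2))
  have hf : IsClosedChain f := by
    intro w
    by_cases hw : w ∈ verticesOf T
    · rw [← vertexEdgeMatrix_mulVec_apply hfT ⟨w, hw⟩, hfx]
      exact congrFun hx _
    · refine Finset.sum_eq_zero fun e he => ?_
      by_contra hne
      exact hw (mem_verticesOf_of_mem_edgesOf (hfT e hne) (Finset.mem_filter.1 he).2)
  obtain ⟨S, hST, hS⟩ := h.exists_subset_boundaryChain_eq hD hf hfT
  refine ⟨fun t => if t.1 ∈ S then 1 else 0, funext fun e => ?_⟩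
  rw [Matrix.mulVecLin_apply, edgeTriangleMatrix_mulVec_apply hST, hS]
  exact congrFun hfx e

theorem apply_mem_verticesOf (h : IsFilledPolygon D N c T) {i : ℕ} (hi : i < N) :
    c i ∈ verticesOf T :=
  mem_verticesOf_of_mem_edgesOf
    (h.pathEdges_subset_edgesOf (mem_pathEdges.2 ⟨i, hi, rfl⟩)) (Finset.mem_insert_self _ _)

/-- The inequality `χ ≥ 1` for the Euler characteristic of the filling. -/
theorem card_edgesOf_add_one_le [Finite W] (hD : IsDisc D) (h : IsFilledPolygon D N c T) :
    #(edgesOf T) + 1 ≤ #T + #(verticesOf T) := by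
  have hpos : 0 < N := by have := h.three_le; lia
  simpa using finrank_add_one_le (h.ker_vertexEdgeMatrix_le hD)
    (range_vertexEdgeMatrix_ne_top ⟨_, h.apply_mem_verticesOf hpos⟩)

theorem three_mul_card_add (hD : IsSurface D) (h : IsFilledPolygon D N c T) :
    3 * #T + N = 2 * #(edgesOf T) := by
  have hdeg (e : Finset W) (he : e ∈ edgesOf T) :
      edgeDegree T e + (if e ∈ pathEdges c N then 1 else 0) = 2 := by
    have hcard := (mem_edgesOf.1 he).1
    have hpos := (mem_edgesOf_iff_edgeDegree_pos hcard).1 he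
    have hle := edgeDegree_le_two hD h.isTriangles hcard
    have heven := h.even_edgeDegree_iff hcard
    grind
  have hsum := Finset.sum_congr rfl hdeg
  rwa [Finset.sum_add_distrib, sum_edgeDegree h.isTriangles, ← Finset.card_filter,
    Finset.filter_mem_eq_inter, Finset.inter_eq_right.2 h.pathEdges_subset_edgesOf,
    h.card_pathEdges, Finset.sum_const, smul_eq_mul, mul_comm _ 2] at hsum

theorem isInterior_and_degree_le_angle (hD : IsSurface D) (h : IsFilledPolygon D N c T) {w : W}
    (hw : w ∈ verticesOf T) (hwc : w ∉ (Finset.range N).image c) :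
    IsInterior D w ∧ degree D w ≤ angle T w := by
  refine STUniform.isInterior_and_degree_le_angle hD h.isTriangles (fun x hwx => ?_)
    (mem_verticesOf.1 hw)
  rw [h.even_edgeDegree_iff (Finset.card_pair hwx), mem_pathEdges]
  rintro ⟨i, hi, he⟩
  have hmem : w ∈ ({c i, c (i + 1)} : Finset W) := he ▸ Finset.mem_insert_self _ _
  rw [Finset.mem_insert, Finset.mem_singleton] at hmem
  refine hwc (Finset.mem_image.2 ?_)
  rcases hmem with rfl | rfl
  · exact ⟨i, Finset.mem_range.2 hi, rfl⟩
  · obtain hlt | hN := Nat.lt_or_eq_of_le hi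
    · exact ⟨i + 1, Finset.mem_range.2 hlt, rfl⟩
    · exact ⟨0, Finset.mem_range.2 (by lia), by rw [← h.closed, ← hN]⟩

/-- Gauss–Bonnet in nonpositive curvature: the exterior angles `3 - angle T (c i)` of the polygon
add up to at least `6`, which stands for `2π`. -/
theorem sum_angle_add_six_le [Finite W] (hD : IsDisc D)
    (hdeg : ∀ w, IsInterior D w → 6 ≤ degree D w) (h : IsFilledPolygon D N c T) :
    ∑ i ∈ Finset.range N, angle T (c i) + 6 ≤ 3 * N := by
  have hinj : Set.InjOn c (Finset.range N) := by simpa using h.injOn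
  have hsub : (Finset.range N).image c ⊆ verticesOf T := by
    intro w hw
    obtain ⟨i, hi, rfl⟩ := Finset.mem_image.1 hw
    exact h.apply_mem_verticesOf (Finset.mem_range.1 hi)
  have hinner : #(verticesOf T \ (Finset.range N).image c) * 6 ≤
      ∑ w ∈ verticesOf T \ (Finset.range N).image c, angle T w := by
    rw [← smul_eq_mul]
    refine Finset.card_nsmul_le_sum _ _ _ fun w hw => ?_
    rw [Finset.mem_sdiff] at hw
    obtain ⟨hint, hle⟩ := h.isInterior_and_degree_le_angle hD.surface hw.1 hw.2
    exact (hdeg w hint).trans hle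
  have hcard := Finset.card_sdiff_add_card_eq_card hsub
  rw [Finset.card_image_of_injOn hinj, Finset.card_range] at hcard
  have hangle := sum_angle h.isTriangles
  rw [← Finset.sum_sdiff hsub, Finset.sum_image hinj] at hangle
  have hEuler := h.card_edgesOf_add_one_le hD
  have hedges := h.three_mul_card_add hD.surface
  lia

end IsFilledPolygon

end FilledPolygons

section Corners

variable {W : Type*} [DecidableEq W] {D : AbstractSimplicialComplex W} {N : ℕ} {c : ℕ → W}
  {T : Finset (Finset W)}

theorem pathChain_update {i : ℕ} (hi : i + 1 < N) (y : W) :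
    pathChain (Function.update c (i + 1) y) N +
        (edgeChain (c i) (c (i + 1)) + edgeChain (c (i + 1)) (c (i + 2))) =
      pathChain c N + (edgeChain (c i) y + edgeChain y (c (i + 2))) := by
  obtain ⟨r, rfl⟩ : ∃ r, N = i + 2 + r := ⟨N - (i + 2), by lia⟩
  have hupd {j : ℕ} (hj : j ≠ i + 1) : Function.update c (i + 1) y j = c j :=
    Function.update_of_ne hj y c
  have hbefore : pathChain (Function.update c (i + 1) y) i = pathChain c i :=
    Finset.sum_congr rfl fun j hj => by
      rw [Finset.mem_range] at hj
      rw [hupd (by lia), hupd (by lia)]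
  have hafter : ∑ j ∈ Finset.range r, edgeChain (Function.update c (i + 1) y (i + 2 + j))
      (Function.update c (i + 1) y (i + 2 + j + 1)) =
      ∑ j ∈ Finset.range r, edgeChain (c (i + 2 + j)) (c (i + 2 + j + 1)) :=
    Finset.sum_congr rfl fun j _ => by rw [hupd (by lia), hupd (by lia)]
  simp only [pathChain] at hbefore
  simp only [pathChain, Finset.sum_range_add, Finset.sum_range_succ, hbefore, hafter,
    Function.update_self, hupd i.lt_succ_self.ne, hupd (i + 1).lt_succ_self.ne']
  abel

namespace IsFilledPolygon

theorem angle_pos (h : IsFilledPolygon D N c T) {i : ℕ} (hi : i < N) : 0 < angle T (c i) := by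
  obtain ⟨t, ht⟩ := mem_verticesOf.1 (h.apply_mem_verticesOf hi)
  exact Finset.card_pos.2 ⟨t, Finset.mem_filter.2 ht⟩

theorem exists_triangleLink_adj (h : IsFilledPolygon D N c T) {w x : W} (hwx : w ≠ x)
    (he : {w, x} ∈ pathEdges c N) : ∃ y, (triangleLink T w).Adj x y :=
  STUniform.exists_triangleLink_adj h.isTriangles hwx <|
    (mem_edgesOf_iff_edgeDegree_pos (Finset.card_pair hwx)).1 (h.pathEdges_subset_edgesOf he)

theorem triangleLink_adj_ends (h : IsFilledPolygon D N c T) {i : ℕ} (hi : i + 1 < N) :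
    (∃ x, (triangleLink T (c (i + 1))).Adj (c i) x) ∧
      ∃ x, (triangleLink T (c (i + 1))).Adj (c (i + 2)) x :=
  ⟨h.exists_triangleLink_adj (h.adj i (by lia)).1.symm
      (mem_pathEdges.2 ⟨i, by lia, Finset.pair_comm _ _⟩),
    h.exists_triangleLink_adj (h.adj (i + 1) hi).1 (mem_pathEdges.2 ⟨i + 1, hi, rfl⟩)⟩

theorem ne_add_two (h : IsFilledPolygon D N c T) {i : ℕ} (hi : i + 1 < N) : c i ≠ c (i + 2) := by
  have := h.three_le
  intro hij
  have := h.eq_or_of_apply_eq (by lia) (by lia) hij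
  lia

theorem triangleLink_adj_of_angle_le_one (h : IsFilledPolygon D N c T) {i : ℕ} (hi : i + 1 < N)
    (hangle : angle T (c (i + 1)) ≤ 1) : (triangleLink T (c (i + 1))).Adj (c i) (c (i + 2)) := by
  obtain ⟨⟨x, hx⟩, u, hu⟩ := h.triangleLink_adj_ends hi
  have heq : ({c (i + 1), c i, x} : Finset W) = {c (i + 1), c (i + 2), u} :=
    Finset.card_le_one.1 hangle _ (by simp [hx.2.2.2]) _ (by simp [hu.2.2.2])
  have hmem : c (i + 2) ∈ ({c (i + 1), c i, x} : Finset W) := heq ▸ by simp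
  have := h.ne_add_two hi
  have := hu.2.1
  grind

theorem exists_flip_of_angle_le_two (h : IsFilledPolygon D N c T) {i : ℕ} (hi : i + 1 < N)
    (hangle : angle T (c (i + 1)) ≤ 2)
    (hadj : ¬ (triangleLink T (c (i + 1))).Adj (c i) (c (i + 2))) :
    ∃ y, (triangleLink T (c (i + 1))).Adj (c i) y ∧
      (triangleLink T (c (i + 1))).Adj y (c (i + 2)) := by
  obtain ⟨⟨x, hx⟩, u, hu⟩ := h.triangleLink_adj_ends hi
  have hxb : x ≠ c (i + 2) := by
    rintro rfl
    exact hadj hx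
  obtain ⟨z, hza, hz⟩ : ∃ z ≠ c i, (triangleLink T (c (i + 1))).Adj x z := by
    refine exists_ne_triangleLink_adj h.isTriangles ?_ hx.symm
    rw [h.even_edgeDegree_iff (Finset.card_pair hx.2.2.1)]
    intro he
    have hmem : x ∈ ({c (i + 1), x} : Finset W) := by simp
    obtain heq | heq := h.eq_or_eq_of_mem_pathEdges hi he (by simp) <;> rw [heq] at hmem
    · have := hx.1
      have := hx.2.2.1
      grind
    · have := hx.2.2.1
      grind
  refine ⟨x, hx, ?_⟩
  suffices z = c (i + 2) by rwa [this] at hz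
  by_contra hzb
  have := h.ne_add_two hi
  obtain ⟨hax, hwa, -, hmem_ax⟩ := hx
  obtain ⟨-, -, -, hmem_xz⟩ := hz
  obtain ⟨-, hwb, -, hmem_bu⟩ := hu
  refine hangle.not_gt (Finset.two_lt_card.2 ⟨{c (i + 1), c i, x}, by simp [hmem_ax],
    {c (i + 1), x, z}, by simp [hmem_xz], {c (i + 1), c (i + 2), u}, by simp [hmem_bu], ?_, ?_, ?_⟩)
  · exact ne_of_mem_of_not_mem' (a := c i) (by simp) (by grind)
  · exact (ne_of_mem_of_not_mem' (a := c (i + 2)) (by simp) (by grind)).symm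
  · exact (ne_of_mem_of_not_mem' (a := c (i + 2)) (by simp) (by grind)).symm

theorem exists_ssubset_boundaryChain_eq_update (h : IsFilledPolygon D N c T) {i : ℕ}
    (hi : i + 1 < N) {y : W} (hleft : (triangleLink T (c (i + 1))).Adj (c i) y)
    (hright : (triangleLink T (c (i + 1))).Adj y (c (i + 2))) :
    ∃ T' ⊂ T, boundaryChain T' = pathChain (Function.update c (i + 1) y) N := by
  obtain ⟨hay, hwa, hwy, hmem_ay⟩ := hleft
  obtain ⟨hyb, -, hwb, hmem_yb⟩ := hright
  have hne : ({c (i + 1), c i, y} : Finset W) ≠ {c (i + 1), y, c (i + 2)} := by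
    have := h.ne_add_two hi
    exact ne_of_mem_of_not_mem' (a := c i) (by simp) (by grind)
  have hsub : ({{c (i + 1), c i, y}, {c (i + 1), y, c (i + 2)}} : Finset (Finset W)) ⊆ T := by
    simp [Finset.insert_subset_iff, hmem_ay, hmem_yb]
  refine ⟨_, Finset.sdiff_ssubset hsub (by simp), ?_⟩
  have hsum := Finset.sum_sdiff (f := triangleBoundary) hsub
  rw [Finset.sum_pair hne, ← edgeChain_add_add hwa hay hwy, ← edgeChain_add_add hwy hyb hwb] at hsum
  change boundaryChain _ + _ = boundaryChain T at hsum
  rw [h.boundaryChain_eq, edgeChain_comm (c (i + 1)) (c i)] at hsum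
  linear_combination hsum - pathChain_update (c := c) hi y - chain_add_self (edgeChain (c i) y) -
    chain_add_self (edgeChain y (c (i + 2))) - chain_add_self (edgeChain (c (i + 1)) y)

end IsFilledPolygon

end Corners

section Bigons

variable {W : Type*} {D : AbstractSimplicialComplex W} {ℓ : W → ℕ} {e c : ℕ → W} {r k m : ℕ}

/-- A closed edge path of length `2 * m + r` made of two paths of length `m` on which the level `ℓ`
grows up to `k`, and a path `e 0, …, e r` joining their ends above the level `k`. -/
structure IsBigon (D : AbstractSimplicialComplex W) (ℓ : W → ℕ) (e : ℕ → W) (r k m : ℕ)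
    (c : ℕ → W) : Prop where
  closed : c (2 * m + r) = c 0
  adj : ∀ i < 2 * m + r, (graph D).Adj (c i) (c (i + 1))
  up : ∀ i ≤ m, ℓ (c i) + m = k + i
  down : ∀ i, m + r ≤ i → i ≤ 2 * m + r → ℓ (c i) + i = k + m + r
  mid : ∀ i ≤ r, c (m + i) = e i
  mid_pos : 0 < r
  mid_injOn : Set.InjOn e (Set.Iic r)
  lt_mid : ∀ i, 0 < i → i < r → k < ℓ (e i)

namespace IsBigon

theorem ne_zero (h : IsBigon D ℓ e r k m c) : m ≠ 0 := by
  rintro rfl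
  have hclosed : e r = e 0 := by
    simpa only [← h.mid r le_rfl, ← h.mid 0 (Nat.zero_le r), mul_zero, zero_add] using h.closed
  have := h.mid_injOn (Set.mem_Iic.2 le_rfl) (Set.mem_Iic.2 (Nat.zero_le r)) hclosed
  have := h.mid_pos
  lia

theorem lt_level (h : IsBigon D ℓ e r k m c) {i : ℕ} (hi : m < i) (hi' : i < m + r) :
    k < ℓ (c i) := by
  have := h.lt_mid (i - m) (by lia) (by lia)
  rwa [← h.mid (i - m) (by lia), Nat.add_sub_cancel' hi.le] at this

theorem eq_of_apply_eq_mid (h : IsBigon D ℓ e r k m c) {i j : ℕ} (hi : m ≤ i) (hi' : i ≤ m + r)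
    (hj : m ≤ j) (hj' : j ≤ m + r) (hij : c i = c j) : i = j := by
  have := h.mid (i - m) (by lia)
  have := h.mid (j - m) (by lia)
  have : i - m = j - m := h.mid_injOn (Set.mem_Iic.2 (by lia)) (Set.mem_Iic.2 (by lia)) (by grind)
  lia

theorem lt_and_add_eq_of_apply_eq (h : IsBigon D ℓ e r k m c) {i j : ℕ} (hij : i < j)
    (hj : j < 2 * m + r) (heq : c i = c j) : i < m ∧ i + j = 2 * m + r := by
  have := congrArg ℓ heq
  have hmid := h.eq_of_apply_eq_mid (i := i) (j := j)
  have hup (x : ℕ) := h.up x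
  have hlt (x : ℕ) := h.lt_level (i := x)
  have hdown (x : ℕ) := h.down x
  grind

theorem shorten (h : IsBigon D ℓ e r k m c) {i j : ℕ} (hi : i < m) (hij : i + j = 2 * m + r)
    (heq : c i = c j) : IsBigon D ℓ e r k (m - i) fun x => c (i + x) where
  closed := by rw [show i + (2 * (m - i) + r) = j by lia, add_zero, heq]
  adj x hx := h.adj (i + x) (by lia)
  up x hx := by have := h.up (i + x) (by lia); lia
  down x hx hx' := by have := h.down (i + x) (by lia) (by lia); lia
  mid x hx := by rw [← h.mid x hx, show i + (m - i + x) = m + x by lia]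
  mid_pos := h.mid_pos
  mid_injOn := h.mid_injOn
  lt_mid := h.lt_mid

theorem update (h : IsBigon D ℓ e r k m c) {i : ℕ} (hi : i + 1 < 2 * m + r)
    (hside : i + 1 < m ∨ m + r < i + 1) {y : W} (hy : ℓ y = ℓ (c (i + 1)))
    (hleft : (graph D).Adj (c i) y) (hright : (graph D).Adj y (c (i + 2))) :
    IsBigon D ℓ e r k m (Function.update c (i + 1) y) := by
  have hupd {j : ℕ} (hj : j ≠ i + 1) : Function.update c (i + 1) y j = c j :=
    Function.update_of_ne hj y c
  have hlevel (j : ℕ) : ℓ (Function.update c (i + 1) y j) = ℓ (c j) := by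
    rcases eq_or_ne j (i + 1) with rfl | hj
    · rw [Function.update_self, hy]
    · rw [hupd hj]
  refine ⟨?_, fun j hj => ?_, fun j hj => ?_, fun j hj hj' => ?_, fun j hj => ?_, h.mid_pos,
    h.mid_injOn, h.lt_mid⟩
  · rw [hupd (by lia), hupd (by lia), h.closed]
  · rcases eq_or_ne j i with rfl | hj₁
    · rwa [Function.update_self, hupd (by lia)]
    rcases eq_or_ne j (i + 1) with rfl | hj₂
    · rwa [Function.update_self, hupd (by lia)]
    · rw [hupd hj₂, hupd (by lia)]
      exact h.adj j hj
  · rw [hlevel, h.up j hj]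
  · rw [hlevel, h.down j hj hj']
  · rw [hupd (by lia), h.mid j hj]

end IsBigon

variable [DecidableEq W] {T : Finset (Finset W)}

/-- The triangles of `T` fill a bigon of least length and, among those, of least area. -/
structure IsMinimalBigon (D : AbstractSimplicialComplex W) (ℓ : W → ℕ) (e : ℕ → W) (r k m : ℕ)
    (c : ℕ → W) (T : Finset (Finset W)) : Prop extends IsBigon D ℓ e r k m c where
  isTriangles : IsTriangles D T
  boundaryChain_eq : boundaryChain T = pathChain c (2 * m + r)
  le_length : ∀ m' c', IsBigon D ℓ e r k m' c' → m ≤ m'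
  le_area : ∀ c' T', IsBigon D ℓ e r k m c' → IsTriangles D T' →
    boundaryChain T' = pathChain c' (2 * m + r) → #T ≤ #T'

theorem IsBigon.exists_isMinimalBigon [Finite W] (hD : IsSimplyConnected D)
    (h : IsBigon D ℓ e r k m c) : ∃ m c T, IsMinimalBigon D ℓ e r k m c T := by
  obtain ⟨m₀, ⟨c₀, hc₀⟩, hmin⟩ : ∃ m₀ ∈ {m | ∃ c, IsBigon D ℓ e r k m c}, ∀ m',
      (∃ c', IsBigon D ℓ e r k m' c') → m₀ ≤ m' :=
    ⟨_, Nat.sInf_mem ⟨m, c, h⟩, fun _ hm => Nat.sInf_le hm⟩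
  let fillings : Set (Finset (Finset W)) :=
    {T | ∃ c, IsBigon D ℓ e r k m₀ c ∧ IsTriangles D T ∧ boundaryChain T = pathChain c (2 * m₀ + r)}
  have hne : fillings.Nonempty := by
    obtain ⟨T, hT⟩ := pathChain_mem_boundaries hD hc₀.adj hc₀.closed
    exact ⟨T, c₀, hc₀, hT⟩
  obtain ⟨T, ⟨c, hc, hT, hbd⟩, hTmin⟩ := Set.exists_min_image fillings Finset.card
    (Set.toFinite _) hne
  exact ⟨m₀, c, T, hc, hT, hbd, fun m' c' hc' => hmin m' ⟨c', hc'⟩,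
    fun c' T' hc' hT' hbd' => hTmin T' ⟨c', hc', hT', hbd'⟩⟩

namespace IsMinimalBigon

theorem isPolygon (h : IsMinimalBigon D ℓ e r k m c T) : IsPolygon D (2 * m + r) c := by
  have hm := h.ne_zero
  have hr := h.mid_pos
  have hinj {i j : ℕ} (hij : i < j) (hj : j < 2 * m + r) : c i ≠ c j := by
    intro heq
    obtain ⟨him, hsum⟩ := h.lt_and_add_eq_of_apply_eq hij hj heq
    have := h.le_length _ _ (h.shorten him hsum heq)
    lia
  refine ⟨by lia, h.closed, fun i hi j hj hij => ?_, h.adj⟩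
  rcases lt_trichotomy i j with hlt | rfl | hlt
  exacts [(hinj hlt hj hij).elim, rfl, (hinj hlt hi hij.symm).elim]

theorem isFilledPolygon (h : IsMinimalBigon D ℓ e r k m c T) :
    IsFilledPolygon D (2 * m + r) c T :=
  ⟨h.isPolygon, h.isTriangles, h.boundaryChain_eq⟩

-- With angle at most `2`, the corner could be cut off, which skips a level, or flipped, which
-- decreases the area.
theorem three_le_angle (hℓ : ∀ a b, (graph D).Adj a b → ℓ b ≤ ℓ a + 1)
    (h : IsMinimalBigon D ℓ e r k m c T) {i : ℕ} (hi : i + 1 < 2 * m + r)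
    (hside : i + 1 < m ∨ m + r < i + 1) : 3 ≤ angle T (c (i + 1)) := by
  have hlevel : (ℓ (c (i + 1)) = ℓ (c i) + 1 ∧ ℓ (c (i + 2)) = ℓ (c (i + 1)) + 1) ∨
      (ℓ (c i) = ℓ (c (i + 1)) + 1 ∧ ℓ (c (i + 1)) = ℓ (c (i + 2)) + 1) := by
    have hup (x : ℕ) := h.up x
    have hdown (x : ℕ) := h.down x
    grind
  have hadj {a b : W} (hab : (triangleLink T (c (i + 1))).Adj a b) : (graph D).Adj a b :=
    (h.isTriangles.adj_of_triangleLink_adj hab).2.2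
  have hℓ' {a b : W} (hab : (triangleLink T (c (i + 1))).Adj a b) : ℓ b ≤ ℓ a + 1 ∧ ℓ a ≤ ℓ b + 1 :=
    ⟨hℓ _ _ (hadj hab), hℓ _ _ (hadj hab).symm⟩
  by_contra! hlt
  obtain ⟨y, hleft, hright⟩ := h.isFilledPolygon.exists_flip_of_angle_le_two hi (by lia)
    fun hab => by have := hℓ' hab; lia
  have hy : ℓ y = ℓ (c (i + 1)) := by
    have := hℓ' hleft
    have := hℓ' hright
    lia
  obtain ⟨T', hsub, hbd⟩ :=
    h.isFilledPolygon.exists_ssubset_boundaryChain_eq_update hi hleft hright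
  exact (Finset.card_lt_card hsub).not_ge (h.le_area _ _
    (h.update hi hside hy (hadj hleft) (hadj hright)) (fun t ht => h.isTriangles t (hsub.1 ht)) hbd)

theorem sum_angle_add_one_le [Finite W] (hD : IsDisc D)
    (hdeg : ∀ w, IsInterior D w → 6 ≤ degree D w) (hℓ : ∀ a b, (graph D).Adj a b → ℓ b ≤ ℓ a + 1)
    (h : IsMinimalBigon D ℓ e r k m c T) :
    ∑ i ∈ Finset.range (r + 1), angle T (e i) + 1 ≤ 3 * r := by
  have hGB := h.isFilledPolygon.sum_angle_add_six_le hD hdeg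
  have hm := h.ne_zero
  have hapex := h.isFilledPolygon.angle_pos (i := 0) (by lia)
  obtain ⟨n, rfl⟩ : ∃ n, m = n + 1 := ⟨m - 1, by lia⟩
  have hup : n * 3 ≤ ∑ i ∈ Finset.range n, angle T (c (i + 1)) := by
    simpa only [Finset.card_range, smul_eq_mul] using Finset.card_nsmul_le_sum (Finset.range n)
      (fun i => angle T (c (i + 1))) 3 fun i hi => by
        rw [Finset.mem_range] at hi
        exact h.three_le_angle hℓ (by lia) (by lia)
  have hdown : n * 3 ≤ ∑ i ∈ Finset.range n, angle T (c (n + 1 + (r + 1) + i)) := by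
    simpa only [Finset.card_range, smul_eq_mul] using Finset.card_nsmul_le_sum (Finset.range n)
      (fun i => angle T (c (n + 1 + (r + 1) + i))) 3 fun i hi => by
        rw [Finset.mem_range] at hi
        rw [show n + 1 + (r + 1) + i = n + 1 + r + i + 1 by lia]
        exact h.three_le_angle hℓ (by lia) (by lia)
  have hmid : ∑ i ∈ Finset.range (r + 1), angle T (c (n + 1 + i)) =
      ∑ i ∈ Finset.range (r + 1), angle T (e i) :=
    Finset.sum_congr rfl fun i hi => by rw [h.mid i (Finset.mem_range_succ_iff.1 hi)]
  rw [show 2 * (n + 1) + r = (n + 1) + (r + 1) + n by lia, Finset.sum_range_add,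
    Finset.sum_range_add, Finset.sum_range_succ', hmid] at hGB
  lia

end IsMinimalBigon

end Bigons

section Layering

variable {V : Type*} {G : SimpleGraph V}

/-- A level function on a graph with the properties of the distance from a vertex in a disc whose
interior vertices have degree at least six. -/
structure IsLayering (G : SimpleGraph V) (ℓ : V → ℕ) : Prop where
  le_succ : ∀ a b, G.Adj a b → ℓ b ≤ ℓ a + 1
  exists_down : ∀ w k, ℓ w = k + 1 → ∃ x, G.Adj w x ∧ ℓ x = k
  exists_common : ∀ p q k, G.Adj p q → ℓ p = k + 1 → ℓ q = k + 1 →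
    ∃ u, G.Adj p u ∧ G.Adj q u ∧ ℓ u = k
  adj_of_down : ∀ w p q k, p ≠ q → G.Adj w p → G.Adj w q → ℓ w = k + 1 → ℓ p = k → ℓ q = k →
    G.Adj p q

/-- The neighbours of `w` form an induced cycle `c` of length `d`. -/
structure IsNeighborCycle (G : SimpleGraph V) (w : V) (d : ℕ) (c : ZMod d → V) : Prop where
  injective : Function.Injective c
  adj_iff : ∀ x, G.Adj w x ↔ ∃ i, x = c i
  adj_apply_iff : ∀ i j, G.Adj (c i) (c j) ↔ j = i + 1 ∨ i = j + 1

theorem dist_le_dist_add_one (hG : G.Connected) (v : V) {a b : V} (h : G.Adj a b) :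
    G.dist v b ≤ G.dist v a + 1 := by
  rw [← SimpleGraph.dist_eq_one_iff_adj.2 h]
  exact hG.dist_triangle

theorem exists_geodesic (hG : G.Connected) (v p : V) :
    ∃ g : ℕ → V, g 0 = v ∧ g (G.dist v p) = p ∧
      (∀ i < G.dist v p, G.Adj (g i) (g (i + 1))) ∧ ∀ i ≤ G.dist v p, G.dist v (g i) = i := by
  obtain ⟨w, hw⟩ := hG.exists_walk_length_eq_dist v p
  refine ⟨w.getVert, w.getVert_zero, hw ▸ w.getVert_length,
    fun i hi => w.adj_getVert_succ (hw ▸ hi), fun i hi => ?_⟩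
  rw [← SimpleGraph.length_eq_dist_of_subwalk hw (w.isSubwalk_take i), w.take_length, hw,
    min_eq_left hi]

theorem exists_adj_dist_eq (hG : G.Connected) {v p : V} {k : ℕ} (h : G.dist v p = k + 1) :
    ∃ x, G.Adj p x ∧ G.dist v x = k := by
  obtain ⟨g, -, hp, hadj, hdist⟩ := exists_geodesic hG v p
  rw [h] at hp hadj hdist
  exact ⟨g k, hp ▸ (hadj k k.lt_succ_self).symm, hdist k k.le_succ⟩

end Layering

section Discs

variable {W : Type*} {D : AbstractSimplicialComplex W}

theorem exists_isBigon (hD : (graph D).Connected) {v : W} {k r : ℕ} {e : ℕ → W} (hr : 0 < r)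
    (hleft : (graph D).dist v (e 0) = k) (hright : (graph D).dist v (e r) = k)
    (hadj : ∀ i < r, (graph D).Adj (e i) (e (i + 1))) (he : Set.InjOn e (Set.Iic r))
    (hek : ∀ i, 0 < i → i < r → k < (graph D).dist v (e i)) :
    ∃ c, IsBigon D ((graph D).dist v) e r k k c := by
  obtain ⟨g, hg0, hgk, hgadj, hgdist⟩ := exists_geodesic hD v (e 0)
  obtain ⟨g', hg0', hgk', hgadj', hgdist'⟩ := exists_geodesic hD v (e r)
  rw [hleft] at hgk hgadj hgdist
  rw [hright] at hgk' hgadj' hgdist'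
  let c (i : ℕ) : W := if i ≤ k then g i else if i ≤ k + r then e (i - k) else g' (2 * k + r - i)
  have hup {i : ℕ} (hi : i ≤ k) : c i = g i := if_pos hi
  have hmid {i : ℕ} (hi : i ≤ r) : c (k + i) = e i := by
    rcases i.eq_zero_or_pos with rfl | hpos
    · rw [add_zero, hup le_rfl, hgk]
    · simp only [c]
      rw [if_neg (by lia), if_pos (by lia), Nat.add_sub_cancel_left]
  have hdown {i : ℕ} (hi : i ≤ k) : c (2 * k + r - i) = g' i := by
    rcases hi.eq_or_lt with rfl | hlt
    · rw [show 2 * i + r - i = i + r by lia, hmid le_rfl, hgk']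
    · simp only [c]
      rw [if_neg (by lia), if_neg (by lia), Nat.sub_sub_self (by lia)]
  refine ⟨c, ?_, fun i hi => ?_, fun i hi => ?_, fun i hi hi' => ?_, fun i => hmid, hr, he, hek⟩
  · rw [hup (Nat.zero_le k), hg0, ← Nat.sub_zero (2 * k + r), hdown (Nat.zero_le k), hg0']
  · rcases lt_or_ge i k with h | h
    · rw [hup h.le, hup h]
      exact hgadj i h
    obtain ⟨j, rfl⟩ := Nat.exists_eq_add_of_le h
    rcases lt_or_ge j r with hj | hj
    · rw [hmid hj.le, add_assoc, hmid hj]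
      exact hadj j hj
    · obtain ⟨x, hx, hjx⟩ : ∃ x < k, k + j + 1 = 2 * k + r - x :=
        ⟨2 * k + r - (k + j + 1), by lia, by lia⟩
      rw [hjx, show k + j = 2 * k + r - (x + 1) by lia, hdown hx, hdown hx.le]
      exact (hgadj' x hx).symm
  · rw [hup hi, hgdist i hi, add_comm]
  · rw [show i = 2 * k + r - (2 * k + r - i) by lia, hdown (by lia), hgdist' _ (by lia)]
    lia

variable [Finite W]

theorem triangle_mem_faces [DecidableEq W] (hD : IsDisc D)
    (hdeg : ∀ w, IsInterior D w → 6 ≤ degree D w) {x y z : W} (hxy : (graph D).Adj x y)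
    (hyz : (graph D).Adj y z) (hzx : (graph D).Adj z x) : {x, y, z} ∈ D.faces := by
  let c (i : ℕ) : W := if i = 1 then y else if i = 2 then z else x
  have hc : IsPolygon D 3 c := by
    refine ⟨le_rfl, rfl, fun i hi j hj hij => ?_, fun i hi => ?_⟩
    · have := hxy.1
      have := hyz.1
      have := hzx.1
      grind
    · interval_cases i
      exacts [hxy, hyz, hzx]
  obtain ⟨T, hT, hbd⟩ := pathChain_mem_boundaries hD.simplyConnected hc.adj hc.closed
  have hfill : IsFilledPolygon D 3 c T := ⟨hc, hT, hbd⟩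
  have hGB := hfill.sum_angle_add_six_le hD hdeg
  have hpos (i : ℕ) (hi : i < 3) := hfill.angle_pos hi
  simp only [Finset.sum_range_succ, Finset.sum_range_zero] at hGB
  have hmem : {y, x, z} ∈ T := (hfill.triangleLink_adj_of_angle_le_one (i := 0) (by lia) (by
    have := hpos 0
    have := hpos 2
    lia)).2.2.2
  rw [Finset.insert_comm]
  exact (hT _ hmem).1

theorem exists_common_neighbor_of_dist_eq (hD : IsDisc D)
    (hdeg : ∀ w, IsInterior D w → 6 ≤ degree D w) {v p q : W} {k : ℕ} (hpq : (graph D).Adj p q)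
    (hp : (graph D).dist v p = k + 1) (hq : (graph D).dist v q = k + 1) :
    ∃ u, (graph D).Adj p u ∧ (graph D).Adj q u ∧ (graph D).dist v u = k := by
  classical
  let e (i : ℕ) : W := if i = 0 then p else q
  have he : Set.InjOn e (Set.Iic 1) := fun i hi j hj hij => by
    have := hpq.1
    grind
  obtain ⟨c, hc⟩ := exists_isBigon hD.simplyConnected.connected (e := e) one_pos hp hq
    (fun i hi => by obtain rfl := Nat.lt_one_iff.1 hi; exact hpq) he (fun i hi hi' => by lia)
  obtain ⟨m, c, T, hc⟩ := hc.exists_isMinimalBigon hD.simplyConnected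
  have hsum : angle T p + angle T q + 1 ≤ 3 := by
    simpa [Finset.sum_range_succ, e] using hc.sum_angle_add_one_le hD hdeg
      fun a b => dist_le_dist_add_one hD.simplyConnected.connected v
  obtain ⟨n, rfl⟩ := Nat.exists_eq_succ_of_ne_zero hc.ne_zero
  have hcp : c (n + 1) = p := hc.mid 0 (Nat.zero_le 1)
  have hcq : c (n + 2) = q := hc.mid 1 le_rfl
  have hpos : 0 < angle T q := hcq ▸ hc.isFilledPolygon.angle_pos (by lia)
  have htri := hc.isFilledPolygon.triangleLink_adj_of_angle_le_one (i := n) (by lia)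
    (by rw [hcp]; lia)
  rw [hcp, hcq] at htri
  obtain ⟨hpu, -, huq⟩ := hc.isTriangles.adj_of_triangleLink_adj htri
  have := hc.up n n.le_succ
  exact ⟨c n, hpu, huq.symm, by lia⟩

theorem adj_of_adj_of_dist_eq (hD : IsDisc D) (hdeg : ∀ w, IsInterior D w → 6 ≤ degree D w)
    {v p q w : W} {k : ℕ} (hpq : p ≠ q) (hwp : (graph D).Adj w p) (hwq : (graph D).Adj w q)
    (hw : (graph D).dist v w = k + 1) (hp : (graph D).dist v p = k)
    (hq : (graph D).dist v q = k) : (graph D).Adj p q := by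
  classical
  let e (i : ℕ) : W := if i = 0 then p else if i = 1 then w else q
  have he : Set.InjOn e (Set.Iic 2) := fun i hi j hj hij => by
    have := hwp.1
    have := hwq.1
    grind
  have hle {a b : W} : (graph D).Adj a b → (graph D).dist v b ≤ (graph D).dist v a + 1 :=
    dist_le_dist_add_one hD.simplyConnected.connected v
  obtain ⟨c, hc⟩ := exists_isBigon hD.simplyConnected.connected (e := e) two_pos hp hq
    (fun i hi => by
      interval_cases i
      exacts [hwp.symm, hwq])
    he (fun i hi hi' => by
      obtain rfl : i = 1 := by lia
      exact hw.symm ▸ k.lt_succ_self)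
  obtain ⟨m, c, T, hc⟩ := hc.exists_isMinimalBigon hD.simplyConnected
  have hfill := hc.isFilledPolygon
  have hsum : angle T p + angle T w + angle T q + 1 ≤ 6 := by
    simpa [Finset.sum_range_succ, e] using hc.sum_angle_add_one_le hD hdeg fun a b => hle
  obtain ⟨n, rfl⟩ := Nat.exists_eq_succ_of_ne_zero hc.ne_zero
  have hcp : c (n + 1) = p := hc.mid 0 (Nat.zero_le 2)
  have hcw : c (n + 2) = w := hc.mid 1 one_le_two
  have hcq : c (n + 3) = q := hc.mid 2 le_rfl
  have hangle_p : 2 ≤ angle T p := by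
    by_contra! hlt
    have htri := hfill.triangleLink_adj_of_angle_le_one (i := n) (by lia) (by rw [hcp]; lia)
    have := hle (hc.isTriangles.adj_of_triangleLink_adj htri).2.2
    have := hc.up n n.le_succ
    rw [hcw] at *
    lia
  have hangle_q : 2 ≤ angle T q := by
    by_contra! hlt
    have htri := hfill.triangleLink_adj_of_angle_le_one (i := n + 2) (by lia) (by rw [hcq]; lia)
    have := hle (hc.isTriangles.adj_of_triangleLink_adj htri).2.2.symm
    have := hc.down (n + 4) (by lia) (by lia)
    rw [hcw] at *
    lia
  have htri := hfill.triangleLink_adj_of_angle_le_one (i := n + 1) (by lia) (by rw [hcw]; lia)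
  rw [hcp, hcq] at htri
  exact (hc.isTriangles.adj_of_triangleLink_adj htri).2.2

theorem isLayering_dist (hD : IsDisc D) (hdeg : ∀ w, IsInterior D w → 6 ≤ degree D w) (v : W) :
    IsLayering (graph D) ((graph D).dist v) where
  le_succ _ _ := dist_le_dist_add_one hD.simplyConnected.connected v
  exists_down _ _ := exists_adj_dist_eq hD.simplyConnected.connected
  exists_common _ _ _ := exists_common_neighbor_of_dist_eq hD hdeg
  adj_of_down _ _ _ _ := adj_of_adj_of_dist_eq hD hdeg

theorem exists_isNeighborCycle (hD : IsDisc D) (hdeg : ∀ w, IsInterior D w → 6 ≤ degree D w)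
    {w : W} (hw : IsInterior D w) : ∃ c, IsNeighborCycle (graph D) w (degree D w) c := by
  classical
  obtain ⟨d, c, hc⟩ := id hw
  rw [hc.degree_eq]
  have hadj_iff (x : W) : (graph D).Adj w x ↔ ∃ i, x = c i := by
    rw [← singleton_mem_link_iff, hc.singleton_mem_iff]
  refine ⟨c, hc.2.1, hadj_iff, fun i j => ?_⟩
  have hlink : (graph D).Adj (c i) (c j) ↔ (skeleton (vertexLink D w)).Adj (c i) (c j) := by
    have hi := (hadj_iff _).2 ⟨i, rfl⟩
    have hj := (hadj_iff _).2 ⟨j, rfl⟩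
    rw [link_adj_iff]
    exact ⟨fun hij => ⟨hij.1, hi.1, hj.1, triangle_mem_faces hD hdeg hi hij hj.symm⟩,
      fun h => ⟨h.1, _, h.2.2.2, by simp, by simp⟩⟩
  rw [hlink, hc.adj_iff]
  simp only [hc.2.1.eq_iff]
  grind

end Discs

section LocalStructure

variable {V : Type*} {G : SimpleGraph V} {ℓ : V → ℕ} {w : V} {d k : ℕ} {c : ZMod d → V}

theorem zmod_one_two_three_four_ne_zero (hd : 4 < d) :
    (1 : ZMod d) ≠ 0 ∧ (2 : ZMod d) ≠ 0 ∧ (3 : ZMod d) ≠ 0 ∧ (4 : ZMod d) ≠ 0 := by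
  refine ⟨?_, ?_, ?_, ?_⟩
  · exact_mod_cast natCast_zmod_ne_zero one_ne_zero (by lia : 1 < d)
  · exact_mod_cast natCast_zmod_ne_zero two_ne_zero (by lia : 2 < d)
  · exact_mod_cast natCast_zmod_ne_zero three_ne_zero (by lia : 3 < d)
  · exact_mod_cast natCast_zmod_ne_zero four_ne_zero hd

theorem IsLayering.le_and_le_of_adj (hG : IsLayering G ℓ) (hw : ℓ w = k + 1) {x : V}
    (hx : G.Adj w x) : k ≤ ℓ x ∧ ℓ x ≤ k + 2 := by
  have := hG.le_succ _ _ hx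
  have := hG.le_succ _ _ hx.symm
  lia

theorem IsLayering.level_eq_one_iff (hG : IsLayering G ℓ) {v : V} (hv : ∀ w, ℓ w = 0 ↔ w = v)
    (w : V) : ℓ w = 1 ↔ G.Adj v w := by
  constructor
  · intro hw
    obtain ⟨x, hwx, hx⟩ := hG.exists_down w 0 hw
    exact ((hv x).1 hx) ▸ hwx.symm
  · intro hvw
    have := hG.le_succ _ _ hvw
    have := (hv v).2 rfl
    have := (hv w).not.2 hvw.ne'
    lia

namespace IsNeighborCycle

theorem adj (hc : IsNeighborCycle G w d c) (i : ZMod d) : G.Adj w (c i) :=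
  (hc.adj_iff _).2 ⟨i, rfl⟩

theorem eq_add_one_or_of_level_eq (hG : IsLayering G ℓ) (hc : IsNeighborCycle G w d c)
    (hw : ℓ w = k + 1) {i j : ZMod d} (hi : ℓ (c i) = k) (hj : ℓ (c j) = k) (hij : i ≠ j) :
    j = i + 1 ∨ i = j + 1 :=
  (hc.adj_apply_iff i j).1 <|
    hG.adj_of_down w _ _ k (hc.injective.ne hij) (hc.adj i) (hc.adj j) hw hi hj

theorem exists_down_eq (hG : IsLayering G ℓ) (hc : IsNeighborCycle G w d c) (hd : 4 < d)
    (hw : ℓ w = k + 1) :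
    ∃ i m, (m = i ∨ m = i + 1) ∧ ∀ j, ℓ (c j) = k ↔ j = i ∨ j = m := by
  obtain ⟨-, -, h3, -⟩ := zmod_one_two_three_four_ne_zero hd
  have hconsec {i j} (hi : ℓ (c i) = k) (hj : ℓ (c j) = k) (hij : i ≠ j) :=
    hc.eq_add_one_or_of_level_eq hG hw hi hj hij
  obtain ⟨x, hx, hxk⟩ := hG.exists_down w k hw
  obtain ⟨i, rfl⟩ := (hc.adj_iff x).1 hx
  by_cases! hpair : ∃ m, ℓ (c m) = k ∧ ℓ (c (m + 1)) = k
  · obtain ⟨m, hm, hm'⟩ := hpair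
    refine ⟨m, m + 1, Or.inr rfl, fun j => ⟨fun hj => ?_, by rintro (rfl | rfl) <;> assumption⟩⟩
    by_contra! hne
    have := hconsec hj hm hne.1
    have := hconsec hj hm' hne.2
    grind
  · refine ⟨i, i, Or.inl rfl, fun j => ⟨fun hj => ?_, by rintro (rfl | rfl) <;> assumption⟩⟩
    by_contra! hne
    rcases hconsec hj hxk hne.1 with rfl | rfl
    exacts [hpair _ hj hxk, hpair _ hxk hj]

theorem exists_level_iff (hG : IsLayering G ℓ) (hc : IsNeighborCycle G w d c) (hd : 4 < d)
    (hw : ℓ w = k + 1) :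
    ∃ i m, (m = i ∨ m = i + 1) ∧ (∀ j, ℓ (c j) = k ↔ j = i ∨ j = m) ∧
      ∀ j, ℓ (c j) = k + 1 ↔ j = i - 1 ∨ j = m + 1 := by
  obtain ⟨h1, h2, -, -⟩ := zmod_one_two_three_four_ne_zero hd
  obtain ⟨i, m, him, hdown⟩ := hc.exists_down_eq hG hd hw
  have hpred : i - 1 ≠ i := sub_eq_self.not.2 h1
  have hsucc : m + 1 ≠ m := add_eq_left.not.2 h1
  have hside {j j'} (hj : ℓ (c j) = k) (hjj' : G.Adj (c j) (c j')) (hj' : ℓ (c j') ≠ k) :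
      ℓ (c j') = k + 1 := by
    have := hG.le_succ _ _ hjj'
    have := (hG.le_and_le_of_adj hw (hc.adj j')).1
    lia
  refine ⟨i, m, him, hdown, fun j => ⟨fun hj => ?_, ?_⟩⟩
  · obtain ⟨u, hwu, hju, hu⟩ := hG.exists_common w (c j) k (hc.adj j) hw hj
    obtain ⟨a, rfl⟩ := (hc.adj_iff u).1 hwu
    have hja := (hc.adj_apply_iff j a).1 hju
    have ha := (hdown a).1 hu
    have hj' : ¬ (j = i ∨ j = m) := by
      rw [← hdown]
      lia
    grind
  · rintro (rfl | rfl)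
    · exact hside ((hdown i).2 (Or.inl rfl)) ((hc.adj_apply_iff _ _).2 (by grind))
        (by rw [Ne, hdown]; grind)
    · exact hside ((hdown m).2 (Or.inr rfl)) ((hc.adj_apply_iff _ _).2 (by grind))
        (by rw [Ne, hdown]; grind)

theorem existsUnique_up (hG : IsLayering G ℓ) (hc : IsNeighborCycle G w d c) (hd : 4 < d)
    (hw : ℓ w = k + 1) {x : V} (hwx : G.Adj w x) (hx : ℓ x = k + 1) :
    ∃! u, G.Adj w u ∧ G.Adj x u ∧ ℓ u = k + 2 := by
  obtain ⟨-, -, h3, h4⟩ := zmod_one_two_three_four_ne_zero hd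
  obtain ⟨i, m, him, hdown, hside⟩ := hc.exists_level_iff hG hd hw
  have hup (j : ZMod d) : ℓ (c j) = k + 2 ↔ j ≠ i ∧ j ≠ m ∧ j ≠ i - 1 ∧ j ≠ m + 1 := by
    have := hG.le_and_le_of_adj hw (hc.adj j)
    have := hdown j
    have := hside j
    grind
  obtain ⟨j, rfl⟩ := (hc.adj_iff x).1 hwx
  rw [hside] at hx
  suffices ∃ a, ∀ b, G.Adj (c j) (c b) ∧ ℓ (c b) = k + 2 ↔ b = a by
    obtain ⟨a, ha⟩ := this
    refine ⟨c a, ⟨hc.adj a, (ha a).2 rfl⟩, ?_⟩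
    rintro y ⟨hwy, hy⟩
    obtain ⟨b, rfl⟩ := (hc.adj_iff y).1 hwy
    rw [(ha b).1 hy]
  simp only [hc.adj_apply_iff, hup]
  rcases hx with rfl | rfl
  · exact ⟨i - 2, fun b => by grind⟩
  · exact ⟨m + 2, fun b => by grind⟩

end IsNeighborCycle

end LocalStructure

section Interedges

variable {V : Type*} {G : SimpleGraph V} [DecidableRel G.Adj]

theorem card_interedges_eq_sum (A B : Finset V) :
    #(G.interedges A B) = ∑ w ∈ A, #{x ∈ B | G.Adj w x} := by
  simp only [SimpleGraph.interedges, Rel.interedges, Finset.card_filter, Finset.sum_product]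

theorem card_interedges_comm (A B : Finset V) : #(G.interedges A B) = #(G.interedges B A) :=
  have := G.symm
  Rel.card_interedges_comm A B

theorem card_interedges_eq_mul {A B : Finset V} {m : ℕ}
    (h : ∀ w ∈ A, #{x ∈ B | G.Adj w x} = m) : #(G.interedges A B) = #A * m := by
  rw [card_interedges_eq_sum, Finset.sum_const_nat h]

end Interedges

section Layers

variable {V : Type*} [Fintype V] {G : SimpleGraph V} [DecidableRel G.Adj] {ℓ : V → ℕ}

open scoped Classical in
/-- The vertices of `S` at level `k`. -/
noncomputable def layer (ℓ : V → ℕ) (S : Set V) (k : ℕ) : Finset V :=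
  {w | ℓ w = k ∧ w ∈ S}

theorem mem_layer {S : Set V} {k : ℕ} {w : V} : w ∈ layer ℓ S k ↔ ℓ w = k ∧ w ∈ S := by
  simp [layer]

theorem filter_layer_eq_filter_univ {S : Set V} {k : ℕ} {p : V → Prop} [DecidablePred p]
    (h : ∀ x, ℓ x = k → p x → x ∈ S) :
    {x ∈ layer ℓ S k | p x} = {x ∈ layer ℓ Set.univ k | p x} := by
  ext x
  simp only [Finset.mem_filter, mem_layer, Set.mem_univ, and_true]
  exact ⟨fun hx => ⟨hx.1.1, hx.2⟩, fun hx => ⟨⟨hx.1, h x hx.1 hx.2⟩, hx.2⟩⟩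

theorem card_filter_layer_add_compl (S : Set V) (k : ℕ) (p : V → Prop) [DecidablePred p] :
    #{x ∈ layer ℓ S k | p x} + #{x ∈ layer ℓ Sᶜ k | p x} = #{x ∈ layer ℓ Set.univ k | p x} := by
  classical
  rw [← Finset.card_filter_add_card_filter_not (s := {x ∈ layer ℓ Set.univ k | p x}) (· ∈ S)]
  congr 2 <;> ext x <;> simp only [Finset.mem_filter, mem_layer] <;> grind

theorem card_layer_add_compl (S : Set V) (k : ℕ) :
    #(layer ℓ S k) + #(layer ℓ Sᶜ k) = #(layer ℓ Set.univ k) := by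
  simpa using card_filter_layer_add_compl (ℓ := ℓ) S k fun _ => True

namespace IsNeighborCycle

variable {w : V} {d k : ℕ} {c : ZMod d → V}

theorem card_layer_filter_adj (hc : IsNeighborCycle G w d c) {s : Finset (ZMod d)}
    (hs : ∀ j, ℓ (c j) = k ↔ j ∈ s) : #{x ∈ layer ℓ Set.univ k | G.Adj w x} = #s := by
  classical
  rw [← Finset.card_image_of_injective s hc.injective]
  congr 1
  ext x
  simp only [Finset.mem_filter, mem_layer, Finset.mem_image, hc.adj_iff]
  grind

theorem card_adj_down (hG : IsLayering G ℓ) (hc : IsNeighborCycle G w d c) (hd : 4 < d)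
    (hw : ℓ w = k + 1) :
    #{x ∈ layer ℓ Set.univ k | G.Adj w x} = 1 ∨ #{x ∈ layer ℓ Set.univ k | G.Adj w x} = 2 := by
  obtain ⟨i, m, -, hi⟩ := hc.exists_down_eq hG hd hw
  rw [hc.card_layer_filter_adj (s := {i, m}) (by simpa using hi)]
  have := Finset.card_pos.2 (Finset.insert_nonempty i {m})
  have := Finset.card_le_two (a := i) (b := m)
  lia

theorem card_adj_side (hG : IsLayering G ℓ) (hc : IsNeighborCycle G w d c) (hd : 4 < d)
    (hw : ℓ w = k + 1) : #{x ∈ layer ℓ Set.univ (k + 1) | G.Adj w x} = 2 := by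
  obtain ⟨-, -, h3, h4⟩ := zmod_one_two_three_four_ne_zero hd
  obtain ⟨i, m, him, -, hi⟩ := hc.exists_level_iff hG hd hw
  rw [hc.card_layer_filter_adj (s := {i - 1, m + 1}) (by simpa using hi), Finset.card_pair]
  grind

theorem card_adj_add (hG : IsLayering G ℓ) (hc : IsNeighborCycle G w d c) (hd : 4 < d)
    (hw : ℓ w = k + 1) :
    #{x ∈ layer ℓ Set.univ k | G.Adj w x} + 2 + #{x ∈ layer ℓ Set.univ (k + 2) | G.Adj w x} =
      d := by
  classical
  have : NeZero d := ⟨by lia⟩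
  have hlevel := fun j (_ : j ∈ Finset.univ) => Finset.mem_Icc.2 (hG.le_and_le_of_adj hw (hc.adj j))
  have hfiber (m : ℕ) :
      #{x ∈ layer ℓ Set.univ m | G.Adj w x} = #{j : ZMod d | ℓ (c j) = m} :=
    hc.card_layer_filter_adj (by simp)
  calc
    _ = #{x ∈ layer ℓ Set.univ k | G.Adj w x} + #{x ∈ layer ℓ Set.univ (k + 1) | G.Adj w x} +
        #{x ∈ layer ℓ Set.univ (k + 2) | G.Adj w x} := by rw [hc.card_adj_side hG hd hw]
    _ = ∑ m ∈ Finset.Icc k (k + 2), #{j : ZMod d | ℓ (c j) = m} := by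
      simp only [hfiber, Finset.sum_Icc_succ_top (show k ≤ k + 1 + 1 by lia),
        Finset.sum_Icc_succ_top (show k ≤ k + 1 by lia), Finset.Icc_self, Finset.sum_singleton]
    _ = #(Finset.univ : Finset (ZMod d)) := (Finset.card_eq_sum_card_fiberwise hlevel).symm
    _ = d := ZMod.card d

end IsNeighborCycle

end Layers

section LayerCounts

variable {V : Type*} [Fintype V] {G : SimpleGraph V} [DecidableRel G.Adj] {ℓ : V → ℕ} {k : ℕ}
  {Q R : Set V}

theorem card_upper_common_neighbors (hG : IsLayering G ℓ)
    (hcyc : ∀ w, ℓ w = k + 1 → ∃ d c, 4 < d ∧ IsNeighborCycle G w d c)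
    (hQR : ∀ w x u, ℓ w = k + 1 → ℓ u = k + 2 → w ∈ Q → x ∈ Q → G.Adj w x → G.Adj w u →
      G.Adj x u → u ∈ R)
    {e : V × V} (he : e ∈ G.interedges (layer ℓ Q (k + 1)) (layer ℓ Q (k + 1))) :
    #{u ∈ layer ℓ R (k + 2) | G.Adj e.1 u ∧ G.Adj e.2 u} = 1 := by
  obtain ⟨w, x⟩ := e
  simp only [SimpleGraph.mem_interedges_iff, mem_layer] at he
  obtain ⟨⟨hw, hwQ⟩, ⟨hx, hxQ⟩, hwx⟩ := he
  obtain ⟨d, c, hd, hc⟩ := hcyc w hw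
  obtain ⟨u, ⟨hwu, hxu, hu⟩, huniq⟩ := hc.existsUnique_up hG hd hw hwx hx
  rw [Finset.card_eq_one]
  refine ⟨u, Finset.eq_singleton_iff_unique_mem.2 ⟨?_, fun y hy => ?_⟩⟩
  · simp only [Finset.mem_filter, mem_layer]
    exact ⟨⟨hu, hQR w x u hw hu hwQ hxQ hwx hwu hxu⟩, hwu, hxu⟩
  · simp only [Finset.mem_filter, mem_layer] at hy
    exact huniq y ⟨hy.2.1, hy.2.2, hy.1.1⟩

/-- The lower neighbours of `u` are one vertex, spanning no edge, or two adjacent vertices. -/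
theorem two_mul_card_lower_neighbors (hG : IsLayering G ℓ) {u : V}
    (hcyc : ∃ d c, 4 < d ∧ IsNeighborCycle G u d c) (hu : ℓ u = k + 2)
    (hQ : ∀ w, ℓ w = k + 1 → G.Adj u w → w ∈ Q) :
    2 * #{w ∈ layer ℓ Set.univ (k + 1) | G.Adj u w} =
      2 + #{e ∈ G.interedges (layer ℓ Q (k + 1)) (layer ℓ Q (k + 1)) |
        G.Adj e.1 u ∧ G.Adj e.2 u} := by
  classical
  obtain ⟨d, c, hd, hc⟩ := hcyc
  have hedges : {e ∈ G.interedges (layer ℓ Q (k + 1)) (layer ℓ Q (k + 1)) |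
      G.Adj e.1 u ∧ G.Adj e.2 u} = {w ∈ layer ℓ Set.univ (k + 1) | G.Adj u w}.offDiag := by
    ext ⟨w, x⟩
    simp only [Finset.mem_filter, SimpleGraph.mem_interedges_iff, mem_layer, Finset.mem_offDiag,
      Set.mem_univ, and_true]
    constructor
    · rintro ⟨⟨⟨hw, -⟩, ⟨hx, -⟩, hwx⟩, hwu, hxu⟩
      exact ⟨⟨hw, hwu.symm⟩, ⟨hx, hxu.symm⟩, hwx.ne⟩
    · rintro ⟨⟨hw, huw⟩, ⟨hx, hux⟩, hne⟩
      exact ⟨⟨⟨hw, hQ w hw huw⟩, ⟨hx, hQ x hx hux⟩,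
        hG.adj_of_down u w x (k + 1) hne huw hux hu hw hx⟩, huw.symm, hux.symm⟩
  rw [hedges, Finset.offDiag_card]
  rcases hc.card_adj_down hG hd hu with h | h <;> rw [h]

/-- Double counting of the triangles with two vertices at level `k + 1` and one at level
`k + 2`. -/
theorem two_mul_card_interedges_down (hG : IsLayering G ℓ)
    (hcyc : ∀ w, ℓ w = k + 1 ∨ ℓ w = k + 2 → ∃ d c, 4 < d ∧ IsNeighborCycle G w d c)
    (hQR : ∀ w x u, ℓ w = k + 1 → ℓ u = k + 2 → w ∈ Q → x ∈ Q → G.Adj w x → G.Adj w u →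
      G.Adj x u → u ∈ R)
    (hRQ : ∀ u w, ℓ u = k + 2 → ℓ w = k + 1 → u ∈ R → G.Adj u w → w ∈ Q) :
    2 * #(G.interedges (layer ℓ R (k + 2)) (layer ℓ Set.univ (k + 1))) =
      2 * #(layer ℓ R (k + 2)) +
        #(G.interedges (layer ℓ Q (k + 1)) (layer ℓ Q (k + 1))) := by
  classical
  let E := G.interedges (layer ℓ Q (k + 1)) (layer ℓ Q (k + 1))
  calc
    _ = ∑ u ∈ layer ℓ R (k + 2), 2 * #{w ∈ layer ℓ Set.univ (k + 1) | G.Adj u w} := by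
      rw [card_interedges_eq_sum, Finset.mul_sum]
    _ = ∑ u ∈ layer ℓ R (k + 2), (2 + #{e ∈ E | G.Adj e.1 u ∧ G.Adj e.2 u}) :=
      Finset.sum_congr rfl fun u hu => by
        obtain ⟨hu, huR⟩ := mem_layer.1 hu
        exact two_mul_card_lower_neighbors hG (hcyc u (Or.inr hu)) hu
          fun w hw => hRQ u w hu hw huR
    _ = 2 * #(layer ℓ R (k + 2)) +
        ∑ e ∈ E, #{u ∈ layer ℓ R (k + 2) | G.Adj e.1 u ∧ G.Adj e.2 u} := by
      rw [Finset.sum_add_distrib, Finset.sum_const, smul_eq_mul, mul_comm]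
      exact congrArg _ (Finset.sum_card_bipartiteAbove_eq_sum_card_bipartiteBelow
        fun (e : V × V) u => G.Adj e.1 u ∧ G.Adj e.2 u).symm
    _ = 2 * #(layer ℓ R (k + 2)) + #E := by
      rw [Finset.sum_const_nat fun e he =>
        card_upper_common_neighbors hG (fun w hw => hcyc w (Or.inl hw)) hQR he, mul_one]

theorem card_interedges_side (hG : IsLayering G ℓ) {A : Finset V}
    (hA : ∀ w ∈ A, ℓ w = k + 1 ∧ ∃ d c, 4 < d ∧ IsNeighborCycle G w d c) :
    #(G.interedges A (layer ℓ Set.univ (k + 1))) = 2 * #A := by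
  rw [mul_comm]
  refine card_interedges_eq_mul fun w hw => ?_
  obtain ⟨hwk, d, c, hd, hc⟩ := hA w hw
  exact hc.card_adj_side hG hd hwk

theorem mul_card_eq_card_interedges (hG : IsLayering G ℓ) {d : ℕ} (hd : 4 < d) {A : Finset V}
    (hA : ∀ w ∈ A, ℓ w = k + 1 ∧ ∃ c, IsNeighborCycle G w d c) :
    d * #A = #(G.interedges A (layer ℓ Set.univ k)) + 2 * #A +
      #(G.interedges A (layer ℓ Set.univ (k + 2))) := by
  simp only [card_interedges_eq_sum]
  rw [mul_comm 2, ← Finset.sum_const_nat fun _ _ => rfl, ← Finset.sum_add_distrib,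
    ← Finset.sum_add_distrib, mul_comm, eq_comm]
  refine Finset.sum_const_nat fun w hw => ?_
  obtain ⟨hwk, c, hc⟩ := hA w hw
  exact hc.card_adj_add hG hd hwk

theorem card_interedges_add_compl (A : Finset V) (S : Set V) (k : ℕ) :
    #(G.interedges A (layer ℓ S k)) + #(G.interedges A (layer ℓ Sᶜ k)) =
      #(G.interedges A (layer ℓ Set.univ k)) := by
  simp only [card_interedges_eq_sum, ← Finset.sum_add_distrib, card_filter_layer_add_compl]

end LayerCounts

/-- A layering whose vertices below level `n` carry the pattern of an `(s, t)`-uniform disc: those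
in `S` have cycles of `s` neighbours outside `S`, the others cycles of `t` neighbours of which every
second one is in `S`. -/
structure IsTypedLayering {V : Type*} (G : SimpleGraph V) (ℓ : V → ℕ) (S : Set V) (s t n : ℕ) :
    Prop extends IsLayering G ℓ where
  exists_cycle_of_mem : ∀ w, ℓ w < n → w ∈ S → ∃ c, IsNeighborCycle G w s c
  exists_cycle_of_notMem : ∀ w, ℓ w < n → w ∉ S → ∃ c, IsNeighborCycle G w t c
  notMem_of_adj : ∀ w x, ℓ w < n → ℓ x < n → w ∈ S → G.Adj w x → x ∉ S
  two_mul_ncard : ∀ w, ℓ w + 1 < n → w ∉ S → 2 * {x | G.Adj w x ∧ x ∈ S}.ncard = t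
  mem_of_triangle : ∀ w x u, ℓ w + 1 < n → w ∉ S → x ∉ S → G.Adj w x → G.Adj w u → G.Adj x u →
    u ∈ S

/-- The numbers of `s`-vertices and of `t`-vertices on the spheres of positive radius centred at an
`s`-vertex; the value at `0` extends the recurrence. -/
noncomputable def sphereCounts (s t : ℝ) : ℕ → ℝ × ℝ
  | 0 => (0, 0)
  | 1 => (0, s)
  | k + 2 => ((t - 4) / 2 * (sphereCounts s t (k + 1)).2 - (sphereCounts s t k).1,
      (s - 4) * (sphereCounts s t (k + 1)).1 + (t - 4) / 2 * (sphereCounts s t (k + 1)).2 -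
        (sphereCounts s t k).2)

namespace IsTypedLayering

variable {V : Type*} {G : SimpleGraph V} {ℓ : V → ℕ} {S : Set V} {s t n k : ℕ}

theorem exists_cycle (h : IsTypedLayering G ℓ S s t n) (hs : 4 < s) (ht : 4 < t) {w : V}
    (hw : ℓ w < n) : ∃ d c, 4 < d ∧ IsNeighborCycle G w d c := by
  by_cases hwS : w ∈ S
  · obtain ⟨c, hc⟩ := h.exists_cycle_of_mem w hw hwS
    exact ⟨s, c, hs, hc⟩
  · obtain ⟨c, hc⟩ := h.exists_cycle_of_notMem w hw hwS
    exact ⟨t, c, ht, hc⟩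

variable [Fintype V]

theorem card_first_layer {v : V} (h : IsTypedLayering G ℓ S s t n)
    (hv : ∀ w, ℓ w = 0 ↔ w = v) (hvS : v ∈ S) (hn : 1 < n) :
    layer ℓ S 1 = ∅ ∧ #(layer ℓ Sᶜ 1) = s := by
  have hv0 := (hv v).2 rfl
  have hnotMem (w) (hw : ℓ w = 1) : w ∉ S :=
    h.notMem_of_adj v w (by lia) (by lia) hvS ((h.toIsLayering.level_eq_one_iff hv w).1 hw)
  refine ⟨?_, ?_⟩
  · refine Finset.eq_empty_of_forall_notMem fun w hw => ?_
    exact hnotMem w (mem_layer.1 hw).1 (mem_layer.1 hw).2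
  · obtain ⟨c, hc⟩ := h.exists_cycle_of_mem v (by lia) hvS
    have hrange : (layer ℓ Sᶜ 1 : Set V) = Set.range c := by
      ext w
      have := h.toIsLayering.level_eq_one_iff hv w
      have := hc.adj_iff w
      simp only [Finset.mem_coe, mem_layer, Set.mem_compl_iff, Set.mem_range]
      grind
    rw [← Set.ncard_coe_finset, hrange, ← Set.image_univ,
      Set.ncard_image_of_injective _ hc.injective, Set.ncard_univ, Nat.card_zmod]

variable [DecidableRel G.Adj]

theorem filter_adj_compl_eq (h : IsTypedLayering G ℓ S s t n) {m : ℕ} (hm : m < n) {w : V}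
    (hw : ℓ w < n) (hwS : w ∈ S) :
    {x ∈ layer ℓ Sᶜ m | G.Adj w x} = {x ∈ layer ℓ Set.univ m | G.Adj w x} :=
  filter_layer_eq_filter_univ fun x hx => h.notMem_of_adj w x hw (hx ▸ hm) hwS

theorem card_interedges_compl_right (h : IsTypedLayering G ℓ S s t n) {l m : ℕ} (hl : l < n)
    (hm : m < n) :
    #(G.interedges (layer ℓ S l) (layer ℓ Sᶜ m)) =
      #(G.interedges (layer ℓ S l) (layer ℓ Set.univ m)) := by
  simp only [card_interedges_eq_sum]
  refine Finset.sum_congr rfl fun w hw => ?_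
  obtain ⟨hw, hwS⟩ := mem_layer.1 hw
  rw [h.filter_adj_compl_eq hm (by lia) hwS]

theorem card_interedges_side_mem (h : IsTypedLayering G ℓ S s t n) (hs : 4 < s)
    (hk : k + 1 < n) :
    #(G.interedges (layer ℓ Sᶜ (k + 1)) (layer ℓ S (k + 1))) = 2 * #(layer ℓ S (k + 1)) := by
  rw [card_interedges_comm, h.card_interedges_compl_right hk hk]
  refine card_interedges_side h.toIsLayering fun w hw => ?_
  obtain ⟨hw, hwS⟩ := mem_layer.1 hw
  exact ⟨hw, s, (h.exists_cycle_of_mem w (by lia) hwS).imp fun _ => And.intro hs⟩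

theorem card_interedges_side_notMem (h : IsTypedLayering G ℓ S s t n) (ht : 4 < t)
    (hk : k + 1 < n) :
    #(G.interedges (layer ℓ Sᶜ (k + 1)) (layer ℓ S (k + 1))) +
      #(G.interedges (layer ℓ Sᶜ (k + 1)) (layer ℓ Sᶜ (k + 1))) = 2 * #(layer ℓ Sᶜ (k + 1)) := by
  rw [card_interedges_add_compl]
  refine card_interedges_side h.toIsLayering fun w hw => ?_
  obtain ⟨hw, hwS⟩ := mem_layer.1 hw
  exact ⟨hw, t, (h.exists_cycle_of_notMem w (by lia) hwS).imp fun _ => And.intro ht⟩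

theorem degree_sum_mem (h : IsTypedLayering G ℓ S s t n) (hs : 4 < s) (hk : k + 2 < n) :
    s * #(layer ℓ S (k + 1)) = #(G.interedges (layer ℓ S (k + 1)) (layer ℓ Sᶜ k)) +
      2 * #(layer ℓ S (k + 1)) + #(G.interedges (layer ℓ Sᶜ (k + 2)) (layer ℓ S (k + 1))) := by
  rw [card_interedges_comm (layer ℓ Sᶜ (k + 2)), h.card_interedges_compl_right (by lia) (by lia),
    h.card_interedges_compl_right (by lia) hk]
  refine mul_card_eq_card_interedges h.toIsLayering hs fun w hw => ?_
  obtain ⟨hw, hwS⟩ := mem_layer.1 hw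
  exact ⟨hw, h.exists_cycle_of_mem w (by lia) hwS⟩

theorem degree_sum_notMem (h : IsTypedLayering G ℓ S s t n) (ht : 4 < t) (hk : k + 2 < n) :
    t * #(layer ℓ Sᶜ (k + 1)) = #(G.interedges (layer ℓ Sᶜ (k + 1)) (layer ℓ S k)) +
      #(G.interedges (layer ℓ Sᶜ (k + 1)) (layer ℓ Sᶜ k)) + 2 * #(layer ℓ Sᶜ (k + 1)) +
      (#(G.interedges (layer ℓ S (k + 2)) (layer ℓ Sᶜ (k + 1))) +
        #(G.interedges (layer ℓ Sᶜ (k + 2)) (layer ℓ Sᶜ (k + 1)))) := by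
  simp only [card_interedges_comm _ (layer ℓ Sᶜ (k + 1)), card_interedges_add_compl]
  refine mul_card_eq_card_interedges h.toIsLayering ht fun w hw => ?_
  obtain ⟨hw, hwS⟩ := mem_layer.1 hw
  exact ⟨hw, h.exists_cycle_of_notMem w (by lia) hwS⟩

theorem alternation_sum (h : IsTypedLayering G ℓ S s t n) (hs : 4 < s) (hk : k + 2 < n) :
    t * #(layer ℓ Sᶜ (k + 1)) = 2 * (#(G.interedges (layer ℓ Sᶜ (k + 1)) (layer ℓ S k)) +
      2 * #(layer ℓ S (k + 1)) + #(G.interedges (layer ℓ S (k + 2)) (layer ℓ Sᶜ (k + 1)))) := by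
  classical
  rw [← h.card_interedges_side_mem hs (by lia), card_interedges_comm (layer ℓ S (k + 2))]
  simp only [card_interedges_eq_sum]
  rw [← Finset.sum_add_distrib, ← Finset.sum_add_distrib, Finset.mul_sum, mul_comm, eq_comm]
  refine Finset.sum_const_nat fun w hw => ?_
  obtain ⟨hw, hwS⟩ := mem_layer.1 hw
  have hcoe : {x | G.Adj w x ∧ x ∈ S} = (({x ∈ layer ℓ S k | G.Adj w x} ∪
      {x ∈ layer ℓ S (k + 1) | G.Adj w x} ∪ {x ∈ layer ℓ S (k + 2) | G.Adj w x} : Finset V) :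
      Set V) := by
    ext x
    simp only [Set.mem_ofPred_eq, Finset.coe_union, Set.mem_union, Finset.mem_coe,
      Finset.mem_filter, mem_layer]
    have := h.toIsLayering.le_and_le_of_adj hw (x := x)
    grind
  rw [← h.two_mul_ncard w (by lia) hwS, hcoe, Set.ncard_coe_finset, Finset.card_union_of_disjoint,
    Finset.card_union_of_disjoint]
  all_goals
    rw [Finset.disjoint_left]
    simp only [Finset.mem_union, Finset.mem_filter, mem_layer]
    lia

/-- Here the triangles have their apex in `S`, so their bases are the edges avoiding `S`. -/
theorem card_interedges_down_mem (h : IsTypedLayering G ℓ S s t n) (hs : 4 < s) (ht : 4 < t)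
    (hk : k + 2 < n) :
    #(G.interedges (layer ℓ S (k + 2)) (layer ℓ Sᶜ (k + 1))) + #(layer ℓ S (k + 1)) =
      #(layer ℓ S (k + 2)) + #(layer ℓ Sᶜ (k + 1)) := by
  have htri := two_mul_card_interedges_down (k := k) (Q := Sᶜ) (R := S) h.toIsLayering
    (fun w hw => h.exists_cycle hs ht (by lia))
    (fun w x u hw _ => h.mem_of_triangle w x u (by lia))
    (fun u w hu hw => h.notMem_of_adj u w (by lia) (by lia))
  have hside := h.card_interedges_side_notMem ht (k := k) (by lia)
  rw [h.card_interedges_side_mem hs (by lia)] at hside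
  rw [h.card_interedges_compl_right (by lia) (by lia)]
  lia

theorem card_interedges_down_add (h : IsTypedLayering G ℓ S s t n) (hs : 4 < s) (ht : 4 < t)
    (hk : k + 2 < n) :
    #(G.interedges (layer ℓ S (k + 2)) (layer ℓ Sᶜ (k + 1))) +
      (#(G.interedges (layer ℓ Sᶜ (k + 2)) (layer ℓ S (k + 1))) +
        #(G.interedges (layer ℓ Sᶜ (k + 2)) (layer ℓ Sᶜ (k + 1)))) =
      #(layer ℓ S (k + 2)) + #(layer ℓ Sᶜ (k + 2)) +
      (#(layer ℓ S (k + 1)) + #(layer ℓ Sᶜ (k + 1))) := by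
  have htri := two_mul_card_interedges_down (k := k) (Q := Set.univ) (R := Set.univ)
    h.toIsLayering (fun w hw => h.exists_cycle hs ht (by lia))
    (fun _ _ _ _ _ _ _ _ _ _ => trivial) (fun _ _ _ _ _ _ => trivial)
  have hside := card_interedges_side (k := k) (A := layer ℓ Set.univ (k + 1)) h.toIsLayering
    fun w hw => ⟨(mem_layer.1 hw).1, h.exists_cycle hs ht (by grind [mem_layer])⟩
  have hsplit := card_interedges_add_compl (G := G) (ℓ := ℓ) (layer ℓ Set.univ (k + 1)) S (k + 2)
  rw [card_interedges_comm _ (layer ℓ S (k + 2)), card_interedges_comm _ (layer ℓ Sᶜ (k + 2)),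
    card_interedges_comm _ (layer ℓ Set.univ (k + 2)), ← h.card_interedges_compl_right hk (by lia),
    ← card_interedges_add_compl _ S (k + 1)] at hsplit
  rw [card_layer_add_compl, card_layer_add_compl]
  lia

theorem card_interedges_first_layer {v : V} (h : IsTypedLayering G ℓ S s t n)
    (hv : ∀ w, ℓ w = 0 ↔ w = v) (hvS : v ∈ S) (hn : 1 < n) :
    #(G.interedges (layer ℓ Sᶜ 1) (layer ℓ S 0)) = s ∧
      #(G.interedges (layer ℓ Sᶜ 1) (layer ℓ Sᶜ 0)) = 0 := by
  have hS : layer ℓ S 0 = {v} := by ext w; grind [mem_layer]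
  have hSc : layer ℓ Sᶜ 0 = ∅ := by ext w; grind [mem_layer]
  rw [hS, hSc, card_interedges_comm, card_interedges_eq_sum, card_interedges_comm]
  refine ⟨?_, by simp⟩
  rw [Finset.sum_singleton, Finset.filter_true_of_mem, (h.card_first_layer hv hvS hn).2]
  exact fun w hw => (h.toIsLayering.level_eq_one_iff hv w).1 (mem_layer.1 hw).1

theorem card_layer_and_card_interedges {v : V} (h : IsTypedLayering G ℓ S s t n) (hs : 4 < s)
    (ht : 4 < t) (hv : ∀ w, ℓ w = 0 ↔ w = v) (hvS : v ∈ S) (k : ℕ) (hk : k + 1 < n) :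
    (#(layer ℓ S (k + 1)) : ℝ) = (sphereCounts s t (k + 1)).1 ∧
    (#(layer ℓ Sᶜ (k + 1)) : ℝ) = (sphereCounts s t (k + 1)).2 ∧
    (#(G.interedges (layer ℓ S (k + 1)) (layer ℓ Sᶜ k)) : ℝ) =
      (sphereCounts s t (k + 1)).1 + (sphereCounts s t k).2 - (sphereCounts s t k).1 ∧
    (#(G.interedges (layer ℓ Sᶜ (k + 1)) (layer ℓ S k)) : ℝ) =
      (sphereCounts s t (k + 1)).2 - (sphereCounts s t (k + 1)).1 + (sphereCounts s t k).1 ∧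
    (#(G.interedges (layer ℓ Sᶜ (k + 1)) (layer ℓ Sᶜ k)) : ℝ) =
      (sphereCounts s t (k + 1)).1 + (sphereCounts s t k).1 := by
  induction k with
  | zero =>
    obtain ⟨hS, hSc⟩ := h.card_first_layer hv hvS hk
    obtain ⟨h1, h2⟩ := h.card_interedges_first_layer hv hvS hk
    simp [sphereCounts, hS, hSc, h1, h2]
  | succ k ih =>
    obtain ⟨hS, hSc, hSSc, hScS, hScSc⟩ := ih (by lia)
    have e1 := congrArg (Nat.cast (R := ℝ)) (h.degree_sum_mem hs hk)
    have e2 := congrArg (Nat.cast (R := ℝ)) (h.degree_sum_notMem ht hk)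
    have e3 := congrArg (Nat.cast (R := ℝ)) (h.alternation_sum hs hk)
    have e4 := congrArg (Nat.cast (R := ℝ)) (h.card_interedges_down_mem hs ht hk)
    have e5 := congrArg (Nat.cast (R := ℝ)) (h.card_interedges_down_add hs ht hk)
    simp only [Nat.cast_add, Nat.cast_mul, Nat.cast_ofNat, hS, hSc, hSSc, hScS, hScSc] at *
    rw [sphereCounts]
    refine ⟨?_, ?_, ?_, ?_, ?_⟩ <;> linarith

end IsTypedLayering

section Limit

open Polynomial Asymptotics
open Polynomial.Chebyshev (S S_add_two)

theorem eval_S_add {R : Type*} [CommRing R] {μ ν : R} (h : μ * ν = 1) (k : ℕ) :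
    (S R k).eval (μ + ν) = μ * (S R (k - 1)).eval (μ + ν) + ν ^ k := by
  induction k with
  | zero => simp
  | succ k ih =>
    have hrec := congrArg (eval (μ + ν)) (S_add_two R ((k : ℤ) - 1))
    rw [show (k : ℤ) - 1 + 2 = k + 1 by ring, sub_add_cancel, eval_sub, eval_mul, eval_X] at hrec
    rw [Nat.cast_add_one, hrec, add_sub_cancel_right, pow_succ]
    linear_combination ν * ih + (S R (k - 1)).eval (μ + ν) * h

theorem abs_eval_S_le {q r : ℝ} {μ ν : ℂ} (hadd : μ + ν = q) (hmul : μ * ν = 1) (hμ : ‖μ‖ ≤ r)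
    (hν : ‖ν‖ ≤ r) (hr : 1 ≤ r) (k : ℕ) : |(S ℝ (k - 1)).eval q| ≤ k * r ^ k := by
  suffices ‖(S ℂ (k - 1)).eval (q : ℂ)‖ ≤ k * r ^ k by
    rwa [← Chebyshev.complex_ofReal_eval_S, Complex.norm_real] at this
  induction k with
  | zero => simp
  | succ k ih =>
    rw [← hadd] at ih ⊢
    rw [Nat.cast_add_one, add_sub_cancel_right, eval_S_add hmul]
    calc ‖μ * (S ℂ (k - 1)).eval (μ + ν) + ν ^ k‖
        ≤ ‖μ‖ * ‖(S ℂ (k - 1)).eval (μ + ν)‖ + ‖ν‖ ^ k := by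
          rw [← norm_mul, ← norm_pow]
          exact norm_add_le _ _
      _ ≤ r * (k * r ^ k) + r ^ (k + 1) := by
          gcongr
          exact (pow_le_pow_left₀ (norm_nonneg ν) hν k).trans (pow_le_pow_right₀ hr k.le_succ)
      _ = (k + 1 : ℕ) * r ^ (k + 1) := by push_cast; ring

theorem pow_le_eval_S {l : ℝ} (hl : 1 < l) (k : ℕ) : l ^ k ≤ (S ℝ k).eval (l + l⁻¹) := by
  have hl0 : 0 < l := by positivity
  induction k with
  | zero => simp
  | succ k ih =>
    rw [eval_S_add (mul_inv_cancel₀ hl0.ne'), Nat.cast_add_one, add_sub_cancel_right, pow_succ']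
    have hpow : 0 < l⁻¹ ^ (k + 1) := by positivity
    linarith [mul_le_mul_of_nonneg_left ih hl0.le]

theorem exists_one_lt_add_inv_eq {p : ℝ} (hp : 2 < p) : ∃ l, 1 < l ∧ l + l⁻¹ = p := by
  refine ⟨Real.exp (Real.arcosh (p / 2)), Real.one_lt_exp_iff.2 (Real.arcosh_pos (by linarith)), ?_⟩
  have h := Real.cosh_arcosh (x := p / 2) (by linarith)
  rw [Real.cosh_eq, Real.exp_neg] at h
  linarith

theorem add_inv_le_add_inv {l m : ℝ} (hl : 1 ≤ l) (hlm : l ≤ m) : l + l⁻¹ ≤ m + m⁻¹ := by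
  have hl0 : 0 < l := by positivity
  have hm0 : 0 < m := by linarith
  have hdiff : m + m⁻¹ - (l + l⁻¹) = (m - l) * (m * l - 1) / (m * l) := by
    field_simp
    ring
  have hlm1 : 0 ≤ m * l - 1 := by nlinarith
  have : 0 ≤ m + m⁻¹ - (l + l⁻¹) := hdiff ▸ by have := sub_nonneg.2 hlm; positivity
  linarith

theorem exists_abs_eval_S_le {q l : ℝ} (hl : 1 < l) (hq : |q| < l + l⁻¹) :
    ∃ r, |r| < l ∧ ∀ k : ℕ, |(S ℝ (k - 1)).eval q| ≤ k * r ^ k := by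
  rcases le_or_gt |q| 2 with hq2 | hq2
  · obtain ⟨hq₁, hq₂⟩ := abs_le.1 hq2
    have hcos : 2 * Complex.cos (Real.arccos (q / 2)) = q := by
      rw [← Complex.ofReal_cos, Real.cos_arccos (by linarith) (by linarith)]
      push_cast
      ring
    refine ⟨1, by simpa using hl,
      abs_eval_S_le ((Complex.two_cos _).symm.trans hcos) ?_ ?_ ?_ le_rfl⟩
    · rw [← Complex.exp_add]
      simp
    · rw [Complex.norm_exp_ofReal_mul_I]
    · rw [← Complex.ofReal_neg, Complex.norm_exp_ofReal_mul_I]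
  · obtain ⟨m, hm, hmq⟩ := exists_one_lt_add_inv_eq hq2
    have hm0 : 0 < m := by linarith
    have hml : m < l := lt_of_not_ge fun h => (add_inv_le_add_inv hl.le h).not_gt (hmq ▸ hq)
    obtain ⟨x, hx, hxq⟩ : ∃ x : ℝ, |x| = m ∧ x + x⁻¹ = q := by
      rcases abs_choice q with h | h
      · exact ⟨m, abs_of_pos hm0, hmq.trans h⟩
      · exact ⟨-m, by rw [abs_neg, abs_of_pos hm0], by rw [inv_neg]; linarith⟩
    have hx0 : x ≠ 0 := abs_pos.1 (hx ▸ hm0)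
    refine ⟨m, by rwa [abs_of_pos hm0], abs_eval_S_le (μ := x) (ν := (x : ℂ)⁻¹)
      (by exact_mod_cast hxq) (mul_inv_cancel₀ (by exact_mod_cast hx0)) ?_ ?_ hm.le⟩
    · rw [Complex.norm_real, Real.norm_eq_abs, hx]
    · rw [norm_inv, Complex.norm_real, Real.norm_eq_abs, hx]
      exact (inv_le_one_of_one_le₀ hm.le).trans hm.le

theorem eval_S_nonneg {p : ℝ} (hp : 2 < p) (k : ℕ) : 0 ≤ (S ℝ (k - 1)).eval p := by
  obtain ⟨l, hl, rfl⟩ := exists_one_lt_add_inv_eq hp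
  cases k with
  | zero => simp
  | succ k =>
    rw [Nat.cast_add_one, add_sub_cancel_right]
    exact (by positivity : 0 ≤ l ^ k).trans (pow_le_eval_S hl k)

theorem tendsto_sum_eval_S {p : ℝ} (hp : 2 < p) :
    Tendsto (fun n => ∑ k ∈ Finset.range n, (S ℝ (k - 1)).eval p) atTop atTop := by
  obtain ⟨l, hl, rfl⟩ := exists_one_lt_add_inv_eq hp
  rw [← tendsto_add_atTop_iff_nat 2]
  refine tendsto_atTop_mono (fun n => ?_) (tendsto_pow_atTop_atTop_of_one_lt hl)
  calc l ^ n ≤ (S ℝ ((n + 1 : ℕ) - 1)).eval (l + l⁻¹) := by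
        rw [Nat.cast_add_one, add_sub_cancel_right]
        exact pow_le_eval_S hl n
    _ ≤ _ := Finset.single_le_sum (f := fun k : ℕ => (S ℝ (k - 1)).eval (l + l⁻¹))
        (fun k _ => eval_S_nonneg hp k) (by simp)

theorem isLittleO_eval_S {p q : ℝ} (hp : 2 < p) (hq : |q| < p) :
    (fun k : ℕ => (S ℝ (k - 1)).eval q) =o[atTop] fun k : ℕ => (S ℝ (k - 1)).eval p := by
  obtain ⟨l, hl, rfl⟩ := exists_one_lt_add_inv_eq hp
  obtain ⟨r, hr, hqr⟩ := exists_abs_eval_S_le hl hq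
  have hO : (fun k : ℕ => (S ℝ (k - 1)).eval q) =O[atTop] fun k : ℕ => (k : ℝ) ^ 1 * r ^ k :=
    .of_norm_le fun k => by simpa using hqr k
  refine (hO.trans_isLittleO
    (isLittleO_pow_const_mul_const_pow_const_pow_of_norm_lt 1 hr)).trans_isBigO ?_
  refine .of_bound l ((eventually_ge_atTop 1).mono fun k hk => ?_)
  obtain ⟨k, rfl⟩ := Nat.exists_eq_add_of_le' hk
  rw [Real.norm_of_nonneg (by positivity), Real.norm_of_nonneg (eval_S_nonneg hp _), pow_succ',
    Nat.cast_add_one, add_sub_cancel_right]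
  exact mul_le_mul_of_nonneg_left (pow_le_eval_S hl k) (by positivity)

section Affine

variable {ι : Type*} {f : Filter ι} {H E : ι → ℝ} {α : ℝ}

theorem isEquivalent_affine (hH : Tendsto H f atTop) (hE : E =o[f] H) (hα : α ≠ 0) (c β : ℝ) :
    (fun n => c + (α * H n + β * E n)) ~[f] fun n => α * H n := by
  have hconst : (fun _ => c) =o[f] H :=
    isLittleO_const_left.2 (.inr (tendsto_norm_atTop_atTop.comp hH))
  refine ((hconst.add (hE.const_mul_left β)).congr_left fun n => ?_).trans_isBigO
    (isBigO_self_const_mul hα H f)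
  simp only [Pi.sub_apply]
  ring

theorem tendsto_affine_div_affine (hH : Tendsto H f atTop) (hE : E =o[f] H) (hα : α ≠ 0)
    (a b c β : ℝ) : Tendsto (fun n => (a + b * E n) / (c + (α * H n + β * E n))) f (𝓝 0) := by
  have hconst : (fun _ => a) =o[f] H :=
    isLittleO_const_left.2 (.inr (tendsto_norm_atTop_atTop.comp hH))
  exact ((hconst.add (hE.const_mul_left b)).trans_isBigO ((isBigO_self_const_mul hα H f).trans
    (isEquivalent_affine hH hE hα c β).isBigO_symm)).tendsto_div_nhds_zero

end Affine

/-- The average curvature of the vertices inside the sphere of radius `n` around an `s`-vertex, as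
computed from `sphereCounts`; the summands `6 - s` and `1` account for the centre. -/
noncomputable def sphereAverage (s t : ℝ) (n : ℕ) : ℝ :=
  (6 - s + ∑ k ∈ Finset.range n,
      ((6 - s) * (sphereCounts s t k).1 + (6 - t) * (sphereCounts s t k).2)) /
    (1 + ∑ k ∈ Finset.range n, ((sphereCounts s t k).1 + (sphereCounts s t k).2))

-- `(s - 4, x)` is a left eigenvector of the matrix of the recursion for `sphereCounts`.
theorem sphereCounts_eigenvector {s t x y : ℝ} (hadd : x + y = (t - 4) / 2)
    (hmul : x * y = -((s - 4) * (t - 4) / 2)) (k : ℕ) :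
    (s - 4) * (sphereCounts s t k).1 + x * (sphereCounts s t k).2 =
      x * s * (S ℝ (k - 1)).eval x := by
  induction k using Nat.twoStepInduction with
  | zero => simp [sphereCounts]
  | one => simp [sphereCounts]
  | more k ih₀ ih₁ =>
    have hx : x ^ 2 = (t - 4) / 2 * x + (s - 4) * (t - 4) / 2 := by
      linear_combination x * hadd - hmul
    have hrec := congrArg (eval x) (S_add_two ℝ ((k : ℤ) - 1))
    rw [eval_sub, eval_mul, eval_X] at hrec
    rw [sphereCounts]
    push_cast at ih₁ ⊢
    ring_nf at hrec ih₀ ih₁ ⊢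
    linear_combination x * ih₁ - ih₀ - (sphereCounts s t (1 + k)).2 * hx - x * s * hrec

section Roots

variable {s t p q : ℝ} (hadd : p + q = (t - 4) / 2) (hmul : p * q = -((s - 4) * (t - 4) / 2))
include hadd hmul

theorem sum_sphereCounts (hs : s ≠ 4) (hpq : p ≠ q) (n : ℕ) :
    ∑ k ∈ Finset.range n, ((sphereCounts s t k).1 + (sphereCounts s t k).2) =
      (s - 4 - q) * (p * s) / ((s - 4) * (p - q)) *
          ∑ k ∈ Finset.range n, (S ℝ (k - 1)).eval p +
        (p - (s - 4)) * (q * s) / ((s - 4) * (p - q)) *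
          ∑ k ∈ Finset.range n, (S ℝ (k - 1)).eval q := by
  rw [Finset.mul_sum, Finset.mul_sum, ← Finset.sum_add_distrib]
  refine Finset.sum_congr rfl fun k _ => ?_
  have hp := sphereCounts_eigenvector hadd hmul k
  have hq := sphereCounts_eigenvector (add_comm p q ▸ hadd) (mul_comm p q ▸ hmul) k
  have hs' : s - 4 ≠ 0 := sub_ne_zero.2 hs
  have hpq' : p - q ≠ 0 := sub_ne_zero.2 hpq
  field_simp
  linear_combination (s - 4 - q) * hp + (p - (s - 4)) * hq

theorem sum_curvature_sphereCounts (hs : s ≠ 4) (n : ℕ) :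
    ∑ k ∈ Finset.range n,
        ((6 - s) * (sphereCounts s t k).1 + (6 - t) * (sphereCounts s t k).2) =
      (2 - p) * ∑ k ∈ Finset.range n, ((sphereCounts s t k).1 + (sphereCounts s t k).2) +
        (p - (s - 4)) * (q * s) / (s - 4) * ∑ k ∈ Finset.range n, (S ℝ (k - 1)).eval q := by
  rw [Finset.mul_sum, Finset.mul_sum, ← Finset.sum_add_distrib]
  refine Finset.sum_congr rfl fun k _ => ?_
  have hq := sphereCounts_eigenvector (add_comm p q ▸ hadd) (mul_comm p q ▸ hmul) k
  have hid : (s - 4 - p) * q = (s - 4) * (t - 4 - p) := by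
    linear_combination (s - 4) * hadd - hmul
  have hs' : s - 4 ≠ 0 := sub_ne_zero.2 hs
  field_simp
  linear_combination (p - (s - 4)) * hq + (sphereCounts s t k).2 * hid

theorem sphereAverage_eq (hs : s ≠ 4) {n : ℕ}
    (hn : 1 + ∑ k ∈ Finset.range n, ((sphereCounts s t k).1 + (sphereCounts s t k).2) ≠ 0) :
    sphereAverage s t n = 2 - p + (4 - s + p + (p - (s - 4)) * (q * s) / (s - 4) *
        ∑ k ∈ Finset.range n, (S ℝ (k - 1)).eval q) /
      (1 + ∑ k ∈ Finset.range n, ((sphereCounts s t k).1 + (sphereCounts s t k).2)) := by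
  rw [sphereAverage, sum_curvature_sphereCounts hadd hmul hs, div_eq_iff hn, add_mul,
    div_mul_cancel₀ _ hn]
  ring

end Roots

theorem tendsto_sphereAverage_of_roots {s t p q : ℝ} (hadd : p + q = (t - 4) / 2)
    (hmul : p * q = -((s - 4) * (t - 4) / 2)) (hs : 4 < s) (hp : 2 < p) (hqp : |q| < p)
    (hq : q < 0) : Tendsto (sphereAverage s t) atTop (𝓝 (2 - p)) := by
  have hH := tendsto_sum_eval_S hp
  have hE := (isLittleO_eval_S hp hqp).sum_range (eval_S_nonneg hp) hH
  have hsum := sum_sphereCounts hadd hmul hs.ne' (by linarith)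
  have hα : 0 < (s - 4 - q) * (p * s) / ((s - 4) * (p - q)) := by
    have hs' : 0 < s - 4 := sub_pos.2 hs
    have hsq : 0 < s - 4 - q := by linarith
    have hpq : 0 < p - q := by linarith
    positivity
  have hlim := (tendsto_affine_div_affine hH hE hα.ne' (4 - s + p)
    ((p - (s - 4)) * (q * s) / (s - 4)) 1
    ((p - (s - 4)) * (q * s) / ((s - 4) * (p - q)))).const_add (2 - p)
  rw [add_zero] at hlim
  have hden := (isEquivalent_affine hH hE hα.ne' 1
    ((p - (s - 4)) * (q * s) / ((s - 4) * (p - q)))).symm.tendsto_atTop (hH.const_mul_atTop hα)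
  refine hlim.congr' ((hden.eventually_ne_atTop 0).mono fun n hn => ?_)
  rw [← hsum] at hn ⊢
  exact (sphereAverage_eq hadd hmul hs.ne' hn).symm

theorem tendsto_sphereAverage {s t : ℝ} (hs : 6 ≤ s) (ht : 6 ≤ t) (hst : 6 < s ∨ 6 < t) :
    Tendsto (sphereAverage s t) atTop
      (𝓝 (2 - ((t - 4) + √((t - 4) ^ 2 + 8 * (s - 4) * (t - 4))) / 4)) := by
  have hsq := Real.sq_sqrt (x := (t - 4) ^ 2 + 8 * (s - 4) * (t - 4)) (by nlinarith)
  have ht_lt : t - 4 < √((t - 4) ^ 2 + 8 * (s - 4) * (t - 4)) :=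
    Real.lt_sqrt_of_sq_lt (by nlinarith)
  have h_lt : 8 - (t - 4) < √((t - 4) ^ 2 + 8 * (s - 4) * (t - 4)) :=
    Real.lt_sqrt_of_sq_lt (by rcases hst with h | h <;> nlinarith)
  set R := √((t - 4) ^ 2 + 8 * (s - 4) * (t - 4))
  refine tendsto_sphereAverage_of_roots (q := ((t - 4) - R) / 4) (by ring)
    (by linear_combination (-1 / 16 : ℝ) * hsq) (by linarith) (by linarith) ?_ (by linarith)
  rw [abs_of_neg (by linarith)]
  linarith

end Limit

section Parity

variable {t : ℕ} (h2 : 2 ∣ t)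

theorem card_filter_castHom_eq_zero [NeZero t] :
    2 * #{i : ZMod t | ZMod.castHom h2 (ZMod 2) i = 0} = t := by
  have hshift : #{i : ZMod t | ZMod.castHom h2 (ZMod 2) i = 0} =
      #{i : ZMod t | ¬ ZMod.castHom h2 (ZMod 2) i = 0} := by
    refine Finset.card_equiv (Equiv.addRight 1) fun i => ?_
    rw [Finset.mem_filter_univ, Finset.mem_filter_univ, Equiv.coe_addRight, map_add, map_one]
    generalize ZMod.castHom h2 (ZMod 2) i = a
    revert a
    decide
  have hcard := Finset.card_filter_add_card_filter_not (s := (Finset.univ : Finset (ZMod t)))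
    (ZMod.castHom h2 (ZMod 2) · = 0)
  rw [Finset.card_univ, ZMod.card] at hcard
  lia

theorem castHom_add_one_eq_zero {i : ZMod t} (hi : ZMod.castHom h2 (ZMod 2) i ≠ 0) :
    ZMod.castHom h2 (ZMod 2) (i + 1) = 0 ∧ ZMod.castHom h2 (ZMod 2) (i - 1) = 0 := by
  rw [map_add, map_sub, map_one]
  generalize ZMod.castHom h2 (ZMod 2) i = a at hi ⊢
  revert a
  decide

end Parity

section Diagram

variable {W : Type*} {D : AbstractSimplicialComplex W} {s t : ℕ}

theorem singleton_mem_fullSpan_iff {w x : W} :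
    {x} ∈ (fullSpan D.toPreAbstractSimplicialComplex ((graph D).neighborSet w)).faces ↔
      (graph D).Adj w x := by
  simp [fullSpan, D.singleton_mem]

theorem fullSpan_adj_iff {w x y : W} :
    (skeleton (fullSpan D.toPreAbstractSimplicialComplex ((graph D).neighborSet w))).Adj x y ↔
      (graph D).Adj x y ∧ (graph D).Adj w x ∧ (graph D).Adj w y := by
  classical
  simp [skeleton_adj_iff, fullSpan, Set.insert_subset_iff, and_assoc]

namespace IsUniformDiagram

theorem six_le_degree (hU : IsUniformDiagram D s t) (hs : 6 ≤ s) (ht : 6 ≤ t) (w : W)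
    (hw : IsInterior D w) : 6 ≤ degree D w := by
  rcases hU.interior w hw with h | h <;> rwa [h.2]

theorem isKVertex_of_not (hU : IsUniformDiagram D s t) {w : W} (hw : IsInterior D w)
    (hws : ¬ IsKVertex D s w) : IsKVertex D t w :=
  (hU.interior w hw).resolve_left hws

-- As `t` is even, the parity of an index of a `t`-cycle is well defined.
theorem exists_parity_cycle (hU : IsUniformDiagram D s t) (hst : s ≠ t) (ht : t ≠ 0) (h2 : 2 ∣ t)
    {w : W} (hw : IsKVertex D t w) (hint : ∀ x, (graph D).Adj w x → IsInterior D x) :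
    ∃ c : ZMod t → W, IsCycleEnum
      (fullSpan D.toPreAbstractSimplicialComplex ((graph D).neighborSet w)) t c ∧
      ∀ i, IsKVertex D s (c i) ↔ ZMod.castHom h2 (ZMod 2) i = 0 := by
  have : NeZero t := ⟨ht⟩
  obtain ⟨c, hc, hparity⟩ := hU.t_vertex w hw
  refine ⟨c, hc, fun i => ?_⟩
  obtain ⟨j, hj, hjt, rfl⟩ : ∃ j : ℕ, 1 ≤ j ∧ j ≤ t ∧ (j : ZMod t) = i :=
    ⟨(i - 1).val + 1, Nat.le_add_left .., ZMod.val_lt _, by simp⟩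
  have hcj := hint _ (singleton_mem_fullSpan_iff.1 (hc.singleton_mem_iff.2 ⟨j, rfl⟩))
  rw [map_natCast, ZMod.natCast_eq_zero_iff_even]
  refine ⟨fun hs => ?_, fun h => ((hparity j hj hjt).2 h).resolve_right (not_not.2 hcj)⟩
  by_contra hodd
  rcases (hparity j hj hjt).1 (Nat.not_even_iff_odd.1 hodd) with htj | htj
  · exact hst (hs.2.symm.trans htj.2)
  · exact htj hcj

theorem two_mul_ncard (hU : IsUniformDiagram D s t) (hst : s ≠ t) (ht : t ≠ 0) (h2 : 2 ∣ t)
    {w : W} (hw : IsKVertex D t w) (hint : ∀ x, (graph D).Adj w x → IsInterior D x) :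
    2 * {x | (graph D).Adj w x ∧ IsKVertex D s x}.ncard = t := by
  classical
  have : NeZero t := ⟨ht⟩
  obtain ⟨c, hc, hparity⟩ := hU.exists_parity_cycle hst ht h2 hw hint
  have himage : {x | (graph D).Adj w x ∧ IsKVertex D s x} =
      (Finset.image c {i | ZMod.castHom h2 (ZMod 2) i = 0} : Finset W) := by
    ext x
    simp only [Set.mem_ofPred_eq, Finset.coe_image, Set.mem_image, Finset.mem_coe,
      Finset.mem_filter_univ, ← singleton_mem_fullSpan_iff, hc.singleton_mem_iff, ← hparity]
    grind
  rw [himage, Set.ncard_coe_finset, Finset.card_image_of_injective _ hc.2.1,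
    card_filter_castHom_eq_zero]

theorem isKVertex_of_triangle (hU : IsUniformDiagram D s t) (hst : s ≠ t) (ht : t ≠ 0)
    (h2 : 2 ∣ t) {w x u : W} (hw : IsKVertex D t w)
    (hint : ∀ x, (graph D).Adj w x → IsInterior D x) (hx : ¬ IsKVertex D s x)
    (hwx : (graph D).Adj w x) (hwu : (graph D).Adj w u) (hxu : (graph D).Adj x u) :
    IsKVertex D s u := by
  obtain ⟨c, hc, hparity⟩ := hU.exists_parity_cycle hst ht h2 hw hint
  obtain ⟨i, rfl⟩ := hc.singleton_mem_iff.1 (singleton_mem_fullSpan_iff.2 hwx)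
  obtain ⟨hsucc, hpred⟩ := castHom_add_one_eq_zero h2 (mt (hparity i).2 hx)
  rcases hc.eq_or_eq_of_adj (fullSpan_adj_iff.2 ⟨hxu, hwx, hwu⟩) with rfl | rfl
  · exact (hparity _).2 hsucc
  · exact (hparity _).2 hpred

theorem isTypedLayering [Finite W] (hU : IsUniformDiagram D s t) (hD : IsDisc D) (hs : 6 ≤ s)
    (ht : 6 ≤ t) (hteven : Even t) (hst : s ≠ t) {v : W} {n : ℕ}
    (hint : ∀ w ∈ inside D v n, IsInterior D w) :
    IsTypedLayering (graph D) ((graph D).dist v) {w | IsKVertex D s w} s t n := by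
  have hdeg := hU.six_le_degree hs ht
  have hlayer := isLayering_dist hD hdeg v
  have hint' {w : W} (hw : (graph D).dist v w + 1 < n) (x : W) (hwx : (graph D).Adj w x) :
      IsInterior D x :=
    hint x ((hlayer.le_succ w x hwx).trans_lt hw)
  have ht0 : t ≠ 0 := by lia
  have hkt {w : W} (hw : (graph D).dist v w + 1 < n) (hws : ¬ IsKVertex D s w) :
      IsKVertex D t w :=
    hU.isKVertex_of_not (hint w (Nat.lt_of_succ_lt hw)) hws
  refine { hlayer with
    exists_cycle_of_mem := fun w hw hws => ?_
    exists_cycle_of_notMem := fun w hw hws => ?_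
    notMem_of_adj := fun w x _ _ hws hwx hxs => hst (hxs.2.symm.trans ?_)
    two_mul_ncard := fun w hw hws =>
      hU.two_mul_ncard hst ht0 hteven.two_dvd (hkt hw hws) (hint' hw)
    mem_of_triangle := fun w x u hw hws hxs =>
      hU.isKVertex_of_triangle hst ht0 hteven.two_dvd (hkt hw hws) (hint' hw) hxs }
  · exact hws.2 ▸ exists_isNeighborCycle hD hdeg (hint w hw)
  · exact (hU.isKVertex_of_not (hint w hw) hws).2 ▸ exists_isNeighborCycle hD hdeg (hint w hw)
  · exact ((hU.s_vertex w hws x hwx).resolve_right (not_not.2 hxs.1)).2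

end IsUniformDiagram

end Diagram

section Average

namespace IsTypedLayering

variable {V : Type*} [Fintype V] {G : SimpleGraph V} {ℓ : V → ℕ} {S : Set V} {s t n : ℕ} {v : V}

theorem card_layer_eq (h : IsTypedLayering G ℓ S s t n) (hs : 4 < s) (ht : 4 < t)
    (hv : ∀ w, ℓ w = 0 ↔ w = v) (hvS : v ∈ S) {k : ℕ} (hk : k < n) :
    (#(layer ℓ S k) : ℝ) = (if k = 0 then 1 else 0) + (sphereCounts s t k).1 ∧
      (#(layer ℓ Sᶜ k) : ℝ) = (sphereCounts s t k).2 := by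
  classical
  cases k with
  | zero =>
    have hS : layer ℓ S 0 = {v} := by ext w; grind [mem_layer]
    have hSc : layer ℓ Sᶜ 0 = ∅ := by ext w; grind [mem_layer]
    simp [hS, hSc, sphereCounts]
  | succ k =>
    obtain ⟨hS, hSc, -⟩ := h.card_layer_and_card_interedges hs ht hv hvS k hk
    simp [hS, hSc]

theorem sum_eq_sum_sphereCounts (h : IsTypedLayering G ℓ S s t n) (hs : 4 < s) (ht : 4 < t)
    (hv : ∀ w, ℓ w = 0 ↔ w = v) (hvS : v ∈ S) (hn : 1 ≤ n) {f : V → ℝ} {x y : ℝ}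
    (hx : ∀ w, ℓ w < n → w ∈ S → f w = x) (hy : ∀ w, ℓ w < n → w ∉ S → f w = y) :
    ∑ w with ℓ w < n, f w =
      x + ∑ k ∈ Finset.range n, (x * (sphereCounts s t k).1 + y * (sphereCounts s t k).2) := by
  classical
  have hlayer (A : Set V) {z : ℝ} (hz : ∀ w, ℓ w < n → w ∈ A → f w = z) {k : ℕ} (hk : k < n) :
      ∑ w ∈ layer ℓ A k, f w = z * #(layer ℓ A k) := by
    rw [Finset.sum_congr rfl fun w hw => hz w ((mem_layer.1 hw).1.trans_lt hk) (mem_layer.1 hw).2,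
      Finset.sum_const, nsmul_eq_mul, mul_comm]
  calc ∑ w with ℓ w < n, f w
      = ∑ k ∈ Finset.range n, ∑ w with ℓ w < n ∧ ℓ w = k, f w := by
        simp only [← Finset.filter_filter]
        exact (Finset.sum_fiberwise_of_maps_to (by simp) _).symm
    _ = ∑ k ∈ Finset.range n,
          (x * (if k = 0 then 1 else 0) +
            (x * (sphereCounts s t k).1 + y * (sphereCounts s t k).2)) := by
        refine Finset.sum_congr rfl fun k hk => ?_
        have hk := Finset.mem_range.1 hk
        have hunion : ({w | ℓ w < n ∧ ℓ w = k} : Finset V) = layer ℓ S k ∪ layer ℓ Sᶜ k := by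
          ext w
          grind [mem_layer]
        have hdisj : Disjoint (layer ℓ S k) (layer ℓ Sᶜ k) :=
          Finset.disjoint_left.2 fun w hw hw' => (mem_layer.1 hw').2 (mem_layer.1 hw).2
        obtain ⟨hS, hSc⟩ := h.card_layer_eq hs ht hv hvS hk
        rw [hunion, Finset.sum_union hdisj, hlayer S hx hk, hlayer Sᶜ hy hk, hS, hSc]
        ring
    _ = _ := by
        rw [Finset.sum_add_distrib]
        simp [Nat.pos_iff_ne_zero.1 hn]

end IsTypedLayering

variable {W : Type*} {D : AbstractSimplicialComplex W}

theorem avgCurvature_eq_sum_div [Fintype W] (v : W) (n : ℕ) :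
    avgCurvature D v n = (∑ w with (graph D).dist v w < n, (6 - (degree D w : ℝ))) /
      ∑ w with (graph D).dist v w < n, (1 : ℝ) := by
  have hinside : inside D v n = (({w | (graph D).dist v w < n} : Finset W) : Set W) := by
    ext w
    simp [inside]
  rw [avgCurvature, hinside, finsum_mem_coe_finset, Set.ncard_coe_finset, Finset.cast_card]

theorem avgCurvature_eq_sphereAverage (hD : IsDisc D) {s t : ℕ} (hs : 6 ≤ s) (ht : 6 ≤ t)
    (hteven : Even t) (hst : s ≠ t) (hU : IsUniformDiagram D s t) {v : W} (hv : IsKVertex D s v)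
    {n : ℕ} (hn : 1 ≤ n) (hint : ∀ w ∈ inside D v n, IsInterior D w) :
    avgCurvature D v n = sphereAverage s t n := by
  have := hD.finite
  have := Fintype.ofFinite W
  have hlayer := hU.isTypedLayering hD hs ht hteven hst hint
  have hv0 (w : W) : (graph D).dist v w = 0 ↔ w = v := by
    rw [hD.simplyConnected.connected.dist_eq_zero_iff, eq_comm]
  have hsum {f : W → ℝ} {x y : ℝ} := hlayer.sum_eq_sum_sphereCounts (f := f) (x := x) (y := y)
    (by lia) (by lia) hv0 hv hn
  rw [avgCurvature_eq_sum_div, sphereAverage,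
    hsum (x := 6 - s) (y := 6 - t) (fun w _ hws => by rw [hws.2])
      (fun w hw hws => by rw [(hU.isKVertex_of_not (hint w hw) hws).2]),
    hsum (x := 1) (y := 1) (fun _ _ _ => rfl) (fun _ _ _ => rfl)]
  simp only [one_mul]

theorem avgCurvature_eq_const [Finite W] {t : ℕ} {v : W} {n : ℕ} (hn : 1 ≤ n)
    (hdeg : ∀ w ∈ inside D v n, degree D w = t) : avgCurvature D v n = 6 - t := by
  have := Fintype.ofFinite W
  have hv : v ∈ ({w | (graph D).dist v w < n} : Finset W) := by simpa using Nat.zero_lt_of_lt hn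
  have hcard : (#{w | (graph D).dist v w < n} : ℝ) ≠ 0 :=
    Nat.cast_ne_zero.2 (Finset.card_ne_zero_of_mem hv)
  rw [avgCurvature_eq_sum_div, Finset.sum_congr rfl fun w hw => by
    rw [hdeg w (Finset.mem_filter.1 hw).2], Finset.sum_const, Finset.sum_const,
    nsmul_eq_mul, nsmul_eq_mul, mul_one, mul_div_cancel_left₀ _ hcard]

theorem two_sub_add_sqrt_div_four {x : ℝ} (hx : 4 ≤ x) :
    2 - ((x - 4) + √((x - 4) ^ 2 + 8 * (x - 4) * (x - 4))) / 4 = 6 - x := by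
  rw [show (x - 4) ^ 2 + 8 * (x - 4) * (x - 4) = (3 * (x - 4)) ^ 2 by ring,
    Real.sqrt_sq (by linarith)]
  ring

end Average

end STUniform

theorem theorem3p4 (s t : ℕ) (hs : 6 ≤ s) (ht : 6 ≤ t) (hteven : Even t)
    (hst : (s, t) ≠ (6, 6)) :
    ∃ κ : ℕ → ℝ,
      (∀ (V : Type*) (X : AbstractSimplicialComplex V), STUniform.IsUniform X s t →
        ∀ γ : PreAbstractSimplicialComplex V, STUniform.IsLoop X γ →
        ∀ (W : Type) (D : AbstractSimplicialComplex W) (f : W → V),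
          STUniform.IsMinimalFilling X γ D f →
        ∀ v : W, STUniform.IsKVertex D s v →
        ∀ n : ℕ, 1 ≤ n → (∀ w ∈ STUniform.inside D v n, STUniform.IsInterior D w) →
          STUniform.avgCurvature D v n = κ n) ∧
      Tendsto κ atTop
        (𝓝 (2 - (((t : ℝ) - 4) +
          √(((t : ℝ) - 4) ^ 2 + 8 * ((s : ℝ) - 4) * ((t : ℝ) - 4))) / 4)) := by
  by_cases h : s = t
  · subst h
    rw [STUniform.two_sub_add_sqrt_div_four (by exact_mod_cast (by lia : 4 ≤ s))]
    refine ⟨fun _ => 6 - s, fun V X hX γ hγ W D f hf v _ n hn hint => ?_, tendsto_const_nhds⟩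
    have := hf.1.disc.finite
    exact STUniform.avgCurvature_eq_const hn fun w hw =>
      (hX.of_eq rfl γ hγ W D f hf w (hint w hw)).2
  · refine ⟨STUniform.sphereAverage s t, fun V X hX γ hγ W D f hf v hv n hn hint =>
      STUniform.avgCurvature_eq_sphereAverage hf.1.disc hs ht hteven h
        (hX.of_ne h γ hγ W D f hf) hv hn hint, ?_⟩
    refine STUniform.tendsto_sphereAverage (by exact_mod_cast hs) (by exact_mod_cast ht) ?_
    exact_mod_cast (by grind : 6 < s ∨ 6 < t)
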